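/- Let $p(m)$ be the number of partitions of the integer $m$ (with $p(0)=1$ and $p(m)=0$ for $m<0$), and for integers $k,n\ge 1$ let $$M_k(n)=(-1)^{k-1}\sum_{j=0}^{k-1}(-1)^j\Big(p\big(n-\tfrac{j(3j+1)}{2}\big)-p\big(n-\tfrac{j(3j+5)}{2}-1\big)\Big)$$ be the Andrews–Merca truncated pentagonal-number function. Let $\varepsilon>0$. Then, as $n\to\infty$, uniformly for integers $k\ge 1$ with $k\ll n^{1/8-\varepsilon}$, $$M_k(n)=\frac{\pi}{12\sqrt2}\,k\,n^{-3/2}e^{2\pi\sqrt n/\sqrt6}+O\!\left(k^3n^{-7/4}e^{2\pi\sqrt n/\sqrt6}\right).$$ That is, for every $\varepsilon>0$ and $C>0$ there are $D>0$ and $N$ such that for all integers $n\ge N$ and $k\ge1$ with $k\le C\,n^{1/8-\varepsilon}$, $$\left|M_k(n)-\frac{\pi}{12\sqrt2}\,k\,n^{-3/2}e^{2\pi\sqrt n/\sqrt6}\right|\le D\,k^3n^{-7/4}e^{2\pi\sqrt n/\sqrt6}.$$ -/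

import Mathlib

/-- The partition function `p`, extended by zero to the negative integers. -/
def partitionCount (m : ℤ) : ℤ :=
  if 0 ≤ m then (Fintype.card (Nat.Partition m.toNat) : ℤ) else 0

/-- The Andrews–Merca function `M_k(n)` (meant for `1 ≤ k`). The two integer divisions by `2`
are exact. -/
def andrewsMercaM (k n : ℕ) : ℤ :=
  (-1) ^ (k - 1) * ∑ j ∈ Finset.range k, (-1) ^ j *
    (partitionCount ((n : ℤ) - (j : ℤ) * (3 * (j : ℤ) + 1) / 2) -
      partitionCount ((n : ℤ) - (j : ℤ) * (3 * (j : ℤ) + 5) / 2 - 1))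

/-!
Write `Δ(m) = p(m) - p(m - 1)`. The `j`-th bracket in `M_k(n)` is the sum of `2 j + 1` consecutive
values `Δ(n - i)`, and all the `i` that occur are below `2 k ^ 2`. Since
`∑_{j < k} (-1) ^ j (2 j + 1) = (-1) ^ (k - 1) k` and `∑_{j < k} (2 j + 1) = k ^ 2`, an estimate
`Δ(n - i) = V + O(δ)` that is uniform in this range gives `M_k(n) = k V + O(k ^ 2 δ)`
(`abs_andrewsMercaM_sub_le`). As `k ^ 2 = O(n ^ (1 / 4))`, the theorem follows from the formula
`Δ(n) = π / (12 √2) n ^ (-3 / 2) e ^ (2 π √(n / 6)) (1 + O(n ^ (-1 / 4)))`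
(`exists_abs_diff_card_partition_sub_le`) and the slow variation of its main term
(`abs_mainTerm_sub_le`).

The formula for `Δ(n)` is proved by the circle method. With `F(q) = ∏ (1 - q ^ n)`, Cauchy's formula
writes `2 π Δ(n)` as the integral of `(1 - q) F(q)⁻¹ q ^ (-n)` over the circle
`q = e ^ (-(x + i y))`, `|y| ≤ π`, of radius given by the saddle point `x = π / √(6 n)`.

* Major arc `y = x u`, `|u| ≤ 1`: the transformation law of the Dedekind eta function gives
  `F(q)⁻¹ = √(τ / 2π) e ^ (π² / (6 τ)) (1 + O(x))` for `τ = x (1 + i u)`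
  (`inv_eulerProd_exp_neg`, `exists_major_arc_factor`). With `l = n x` the integrand then becomes a
  constant times `e ^ (-l u² / (1 + i u)) (1 + O(|u| + x))`, and Laplace's method yields
  `√(π / l) + O(1 / l)` (`norm_integral_sub_sqrt_le`). Errors linear in `u` can be estimated by
  absolute values: they cost a factor `l ^ (-1 / 2)`, of order `n ^ (-1 / 4)`, which is what is
  allowed.
* Minor arc `x ≤ |y| ≤ π`: termwise comparison of Taylor coefficients, keeping only the gain from
  the linear terms, gives `|F(q)⁻¹| ≤ F(|q|)⁻¹ exp (Re (1 - q)⁻¹ - (1 - |q|)⁻¹)`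
  (`norm_inv_eulerProd_le`), and the exponent is at most `-1 / (20 x)`.
-/

/-! ### The generating function of the partitions -/

/-- The Euler product `∏_{n ≥ 1} (1 - q ^ n)`. -/
noncomputable def eulerProd (q : ℂ) : ℂ := ∏' n : ℕ, (1 - q ^ (n + 1))

lemma one_sub_pow_succ_ne_zero {q : ℂ} (hq : ‖q‖ < 1) (n : ℕ) : 1 - q ^ (n + 1) ≠ 0 := by
  intro h
  have h1 : ‖q ^ (n + 1)‖ < 1 := by
    rw [norm_pow]; exact pow_lt_one₀ (norm_nonneg _) hq (by omega)
  rw [← sub_eq_zero.mp h] at h1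
  simp at h1

lemma eulerProd_ne_zero {q : ℂ} (hq : ‖q‖ < 1) : eulerProd q ≠ 0 := by
  have h := tprod_one_add_ne_zero_of_summable (R := ℂ) (f := fun n : ℕ ↦ -q ^ (n + 1))
    (fun n ↦ by simpa [sub_eq_add_neg] using one_sub_pow_succ_ne_zero hq n)
    (by simpa using (summable_nat_add_iff 1).mpr (summable_geometric_of_lt_one (norm_nonneg _) hq))
  simpa [eulerProd, sub_eq_add_neg] using h

lemma tendsto_prod_eulerProd {q : ℂ} (hq : ‖q‖ < 1) :
    Filter.Tendsto (fun N ↦ ∏ i ∈ Finset.range N, (1 - q ^ (i + 1))) Filter.atTop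
      (nhds (eulerProd q)) :=
  (ModularForm.multipliable_one_sub_pow hq).tendsto_prod_tprod_nat

/-- The number of partitions of `n` into parts that are at most `N`. -/
def boundedPartsCount (N n : ℕ) : ℕ := (Nat.Partition.restricted n (· ≤ N)).card

lemma boundedPartsCount_le (N n : ℕ) : boundedPartsCount N n ≤ Fintype.card (Nat.Partition n) :=
  Finset.card_le_univ _

lemma boundedPartsCount_of_le {N n : ℕ} (h : n ≤ N) :
    boundedPartsCount N n = Fintype.card (Nat.Partition n) := by
  rw [boundedPartsCount, Nat.Partition.restricted, Finset.filter_true_of_mem, Finset.card_univ]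
  intro p _ i hi
  exact (p.le_of_mem_parts hi).trans h

/-- The power series `1 / (1 - X ^ m)`. -/
noncomputable def geomSeries (m : ℕ) : PowerSeries ℂ :=
  PowerSeries.mk fun n ↦ if m ∣ n then 1 else 0

open PowerSeries PowerSeries.WithPiTopology in
lemma tsum_X_pow_eq_geomSeries (i : ℕ) :
    ∑' j : ℕ, (X : PowerSeries ℂ) ^ ((i + 1) * j) = geomSeries (i + 1) := by
  refine HasSum.tsum_eq ?_
  rw [hasSum_iff_hasSum_coeff]
  intro d
  simp only [coeff_X_pow, geomSeries, coeff_mk]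
  by_cases h : (i + 1) ∣ d
  · obtain ⟨j, rfl⟩ := h
    simp only [dvd_mul_right, if_true]
    refine (hasSum_ite_eq j (1 : ℂ)).congr_fun fun b ↦ ?_
    simp [eq_comm]
  · rw [if_neg h]
    convert hasSum_zero with b
    rw [if_neg]
    rintro rfl
    exact h (dvd_mul_right _ _)

open PowerSeries PowerSeries.WithPiTopology in
lemma mk_boundedPartsCount (N : ℕ) :
    PowerSeries.mk (fun n ↦ (boundedPartsCount N n : ℂ)) =
      ∏ i ∈ Finset.range N, geomSeries (i + 1) := by
  have h := Nat.Partition.powerSeriesMk_card_restricted_eq_tprod ℂ (· ≤ N)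
  simp only [boundedPartsCount]
  rw [h, tprod_eq_prod (s := Finset.range N)]
  · refine Finset.prod_congr rfl fun i hi ↦ ?_
    rw [if_pos (by simpa [Nat.succ_le_iff] using hi), tsum_X_pow_eq_geomSeries]
  · intro i hi
    rw [if_neg (by simpa using hi)]

lemma hasSum_geomSeries {q : ℂ} (hq : ‖q‖ < 1) {m : ℕ} (hm : m ≠ 0) :
    HasSum (fun n ↦ PowerSeries.coeff n (geomSeries m) * q ^ n) (1 - q ^ m)⁻¹ := by
  have h1 : ‖q ^ m‖ < 1 := by
    rw [norm_pow]; exact pow_lt_one₀ (norm_nonneg _) hq hm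
  have hinj : Function.Injective (fun j : ℕ ↦ m * j) :=
    fun a b hab ↦ Nat.eq_of_mul_eq_mul_left (Nat.pos_of_ne_zero hm) hab
  rw [← hinj.hasSum_iff]
  · refine (hasSum_geometric_of_norm_lt_one h1).congr_fun fun j ↦ ?_
    simp [geomSeries, pow_mul]
  · intro n hn
    simp only [geomSeries, PowerSeries.coeff_mk]
    rw [if_neg, zero_mul]
    rintro ⟨j, rfl⟩
    exact hn ⟨j, rfl⟩

/-- Evaluation of power series at a point where both factors converge absolutely is
multiplicative. -/
lemma powerSeries_eval_mul {φ ψ : PowerSeries ℂ} {q : ℂ}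
    (hφ : Summable fun n ↦ ‖PowerSeries.coeff n φ * q ^ n‖)
    (hψ : Summable fun n ↦ ‖PowerSeries.coeff n ψ * q ^ n‖) :
    Summable (fun n ↦ ‖PowerSeries.coeff n (φ * ψ) * q ^ n‖) ∧
    ∑' n, PowerSeries.coeff n (φ * ψ) * q ^ n =
      (∑' n, PowerSeries.coeff n φ * q ^ n) * ∑' n, PowerSeries.coeff n ψ * q ^ n := by
  obtain ⟨f, hf⟩ : ∃ f : ℕ → ℂ, f = fun n ↦ PowerSeries.coeff n φ * q ^ n := ⟨_, rfl⟩
  obtain ⟨g, hg⟩ : ∃ g : ℕ → ℂ, g = fun n ↦ PowerSeries.coeff n ψ * q ^ n := ⟨_, rfl⟩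
  have key : (fun n ↦ PowerSeries.coeff n (φ * ψ) * q ^ n) =
      fun n ↦ ∑ kl ∈ Finset.HasAntidiagonal.antidiagonal n, f kl.1 * g kl.2 := by
    ext n
    rw [PowerSeries.coeff_mul, Finset.sum_mul]
    refine Finset.sum_congr rfl fun kl hkl ↦ ?_
    rw [← Finset.HasAntidiagonal.mem_antidiagonal.mp hkl, pow_add, hf, hg]
    ring
  have hf' : Summable fun n ↦ ‖f n‖ := by rw [hf]; exact hφ
  have hg' : Summable fun n ↦ ‖g n‖ := by rw [hg]; exact hψ
  refine ⟨?_, ?_⟩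
  · have h := summable_norm_sum_mul_antidiagonal_of_summable_norm hf' hg'
    exact h.congr fun n ↦ by rw [← congrFun key n]
  · rw [key, ← hf, ← hg, tsum_mul_tsum_eq_tsum_sum_antidiagonal_of_summable_norm hf' hg']

lemma prod_geomSeries_eval {q : ℂ} (hq : ‖q‖ < 1) (N : ℕ) :
    Summable (fun n ↦ ‖PowerSeries.coeff n (∏ i ∈ Finset.range N, geomSeries (i + 1)) * q ^ n‖) ∧
    ∑' n, PowerSeries.coeff n (∏ i ∈ Finset.range N, geomSeries (i + 1)) * q ^ n =
      ∏ i ∈ Finset.range N, (1 - q ^ (i + 1))⁻¹ := by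
  induction N with
  | zero =>
    have h : ∀ n, n ≠ 0 → PowerSeries.coeff n (∏ i ∈ Finset.range 0, geomSeries (i + 1)) * q ^ n
        = 0 := fun n hn ↦ by simp [PowerSeries.coeff_one, hn]
    refine ⟨summable_of_ne_finset_zero (s := {0}) fun n hn ↦ ?_, ?_⟩
    · rw [h n (by simpa using hn), norm_zero]
    · rw [tsum_eq_single 0 h]; simp
  | succ N ih =>
    have hg := hasSum_geomSeries hq (Nat.succ_ne_zero N)
    have h := powerSeries_eval_mul ih.1 hg.summable.norm
    rw [Finset.prod_range_succ, Finset.prod_range_succ]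
    exact ⟨h.1, by rw [h.2, ih.2, hg.tsum_eq]⟩

/-- The number of partitions into parts at most `N` has generating function
`∏_{i ≤ N} 1 / (1 - q ^ i)`. -/
lemma hasSum_boundedPartsCount {q : ℂ} (hq : ‖q‖ < 1) (N : ℕ) :
    HasSum (fun n ↦ (boundedPartsCount N n : ℂ) * q ^ n)
      (∏ i ∈ Finset.range N, (1 - q ^ (i + 1))⁻¹) := by
  obtain ⟨h1, h2⟩ := prod_geomSeries_eval hq N
  rw [← h2]
  refine h1.of_norm.hasSum.congr_fun fun n ↦ ?_
  rw [← mk_boundedPartsCount, PowerSeries.coeff_mk]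

lemma tendsto_prod_inv {q : ℂ} (hq : ‖q‖ < 1) :
    Filter.Tendsto (fun N ↦ ∏ i ∈ Finset.range N, (1 - q ^ (i + 1))⁻¹) Filter.atTop
      (nhds (eulerProd q)⁻¹) := by
  simp only [Finset.prod_inv_distrib]
  exact (tendsto_prod_eulerProd hq).inv₀ (eulerProd_ne_zero hq)

lemma summable_card_partition {r : ℝ} (hr0 : 0 ≤ r) (hr : r < 1) :
    Summable fun n ↦ (Fintype.card (Nat.Partition n) : ℝ) * r ^ n := by
  have hq : ‖(r : ℂ)‖ < 1 := by simpa [abs_of_nonneg hr0] using hr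
  -- The partial sums are dominated by the convergent partial products `∏ 1 / (1 - r ^ i)`.
  obtain ⟨B, hB⟩ := (tendsto_prod_inv hq).norm.bddAbove_range
  refine summable_of_sum_range_le (c := B) (fun n ↦ by positivity) fun N ↦ ?_
  have h1 : HasSum (fun n ↦ (boundedPartsCount N n : ℝ) * r ^ n)
      (∏ i ∈ Finset.range N, (1 - r ^ (i + 1))⁻¹) := by
    have := hasSum_boundedPartsCount hq N
    exact_mod_cast this
  calc ∑ n ∈ Finset.range N, (Fintype.card (Nat.Partition n) : ℝ) * r ^ n
      = ∑ n ∈ Finset.range N, (boundedPartsCount N n : ℝ) * r ^ n :=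
        Finset.sum_congr rfl fun n hn ↦ by
          rw [boundedPartsCount_of_le (Finset.mem_range.mp hn).le]
    _ ≤ ∏ i ∈ Finset.range N, (1 - r ^ (i + 1))⁻¹ :=
        sum_le_hasSum _ (fun n _ ↦ by positivity) h1
    _ ≤ ‖∏ i ∈ Finset.range N, (1 - (r : ℂ) ^ (i + 1))⁻¹‖ := by
        have : ∏ i ∈ Finset.range N, (1 - (r : ℂ) ^ (i + 1))⁻¹ =
          ((∏ i ∈ Finset.range N, (1 - r ^ (i + 1))⁻¹ : ℝ) : ℂ) := by push_cast; rfl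
        rw [this, Complex.norm_real]
        exact le_abs_self _
    _ ≤ B := hB ⟨N, rfl⟩

/-- Euler's generating function: `∑ p(n) q ^ n = ∏ 1 / (1 - q ^ n)` in the unit disc. -/
theorem hasSum_card_partition {q : ℂ} (hq : ‖q‖ < 1) :
    HasSum (fun n ↦ (Fintype.card (Nat.Partition n) : ℂ) * q ^ n) (eulerProd q)⁻¹ := by
  have hs := summable_card_partition (norm_nonneg q) hq
  have hs' : Summable fun n ↦ (Fintype.card (Nat.Partition n) : ℂ) * q ^ n :=
    Summable.of_norm (by simpa using hs)
  have hlim := tendsto_tsum_of_dominated_convergence (𝓕 := Filter.atTop)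
    (f := fun N n ↦ (boundedPartsCount N n : ℂ) * q ^ n)
    (g := fun n ↦ (Fintype.card (Nat.Partition n) : ℂ) * q ^ n) hs
    (fun n ↦ tendsto_const_nhds.congr' <| by
      filter_upwards [Filter.eventually_ge_atTop n] with N hN
      rw [boundedPartsCount_of_le hN])
    (Filter.Eventually.of_forall fun N n ↦ by
      rw [norm_mul, norm_pow, Complex.norm_natCast]
      gcongr
      exact boundedPartsCount_le N n)
  simp only [(hasSum_boundedPartsCount hq _).tsum_eq] at hlim
  rw [tendsto_nhds_unique (tendsto_prod_inv hq) hlim]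
  exact hs'.hasSum

/-! ### The modular transformation and the behaviour near `q = 1` -/

open UpperHalfPlane in
lemma I_mul_div_two_pi_mem {x : ℝ} (hx : 0 < x) (u : ℝ) :
    Complex.I * ((x : ℂ) * (1 + u * Complex.I)) / (2 * Real.pi) ∈ upperHalfPlaneSet := by
  have h : (Complex.I * ((x : ℂ) * (1 + u * Complex.I)) / (2 * Real.pi)).im =
      x / (2 * Real.pi) := by
    have : Complex.I * ((x : ℂ) * (1 + u * Complex.I)) / (2 * Real.pi) =
      ((-(x * u) / (2 * Real.pi) : ℝ) : ℂ) + ((x / (2 * Real.pi) : ℝ) : ℂ) * Complex.I := by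
      push_cast
      linear_combination (x : ℂ) * u / (2 * Real.pi) * Complex.I_sq
    rw [this, Complex.add_im, Complex.im_ofReal_mul]
    simp [-Complex.ofReal_div, -Complex.ofReal_mul]
  show 0 < (Complex.I * ((x : ℂ) * (1 + u * Complex.I)) / (2 * Real.pi)).im
  rw [h]
  positivity

/-- The branch of the square root in the eta transformation splits on the right half plane. -/
lemma sqrt_ofReal_mul_I_mul {c : ℝ} (hc : 0 < c) {w : ℂ} (hw : 0 < w.re) :
    Complex.sqrt (c * (Complex.I * w)) =
      Real.sqrt c * (Complex.sqrt Complex.I * Complex.sqrt w) := by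
  have hw0 : w ≠ 0 := by rintro rfl; simp at hw
  have hI : Complex.I ≠ 0 := Complex.I_ne_zero
  have hIw : Complex.I * w ≠ 0 := mul_ne_zero hI hw0
  have harg := (Complex.abs_arg_lt_pi_div_two_iff.mpr (Or.inl hw))
  rw [abs_lt] at harg
  have hlog : Complex.log (Complex.I * w) = Complex.log Complex.I + Complex.log w := by
    rw [Complex.log_mul_eq_add_log_iff hI hw0, Complex.arg_I]
    constructor <;> linarith [Real.pi_pos]
  have hsc : (Real.sqrt c : ℂ) = Complex.exp ((Real.log c : ℂ) / 2) := by
    rw [Real.sqrt_eq_rpow, Real.rpow_def_of_pos hc]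
    push_cast
    congr 1
    ring
  rw [sqrt_eq_exp (mul_ne_zero (by exact_mod_cast hc.ne') hIw),
    Complex.log_ofReal_mul hc hIw, hlog, sqrt_eq_exp hI, sqrt_eq_exp hw0, hsc,
    ← Complex.exp_add, ← Complex.exp_add]
  congr 1
  ring

lemma eta_eq_exp_mul_eulerProd {z : ℂ} :
    ModularForm.eta z = Complex.exp (2 * Real.pi * Complex.I * z / 24) *
      eulerProd (Complex.exp (2 * Real.pi * Complex.I * z)) := by
  rw [ModularForm.eta, eulerProd]
  simp only [ModularForm.eta_q_eq_pow, Function.Periodic.qParam]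
  push_cast
  rfl

lemma norm_exp_neg_lt_one {τ : ℂ} (hτ : 0 < τ.re) : ‖Complex.exp (-τ)‖ < 1 := by
  rw [Complex.norm_exp]
  simpa using hτ

lemma re_four_pi_sq_div {x : ℝ} (hx : 0 < x) (u : ℝ) :
    (4 * Real.pi ^ 2 / ((x : ℂ) * (1 + u * Complex.I))).re =
      4 * Real.pi ^ 2 / (x * (1 + u ^ 2)) := by
  have hw : (1 + u * Complex.I : ℂ) ≠ 0 := by
    intro h; simpa using congrArg Complex.re h
  have hx' : (x : ℂ) ≠ 0 := by exact_mod_cast hx.ne'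
  have hu : (1 + (u : ℂ) ^ 2) ≠ 0 := by
    have : (1 + u ^ 2 : ℝ) ≠ 0 := by positivity
    exact_mod_cast this
  have : 4 * Real.pi ^ 2 / ((x : ℂ) * (1 + u * Complex.I)) =
      ((4 * Real.pi ^ 2 / (x * (1 + u ^ 2)) : ℝ) : ℂ) +
      ((-(4 * Real.pi ^ 2 * u / (x * (1 + u ^ 2))) : ℝ) : ℂ) * Complex.I := by
    push_cast
    field_simp
    linear_combination (u:ℂ)^2 * Complex.I_sq
  rw [this]
  simp [-Complex.ofReal_div, -Complex.ofReal_mul]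

/-- The transformation of the Dedekind eta function under `z ↦ -1 / z`, written for the generating
function of the partitions at `q = exp (-τ)`, `τ = x (1 + i u)`. -/
theorem inv_eulerProd_exp_neg {x : ℝ} (hx : 0 < x) (u : ℝ) :
    (eulerProd (Complex.exp (-((x : ℂ) * (1 + u * Complex.I)))))⁻¹ =
      Real.sqrt (x / (2 * Real.pi)) * Complex.sqrt (1 + u * Complex.I) *
        Complex.exp (-((x : ℂ) * (1 + u * Complex.I) / 24)) *
        (eulerProd (Complex.exp (-(4 * Real.pi ^ 2 / ((x : ℂ) * (1 + u * Complex.I))))))⁻¹ *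
        Complex.exp (Real.pi ^ 2 / (6 * ((x : ℂ) * (1 + u * Complex.I)))) := by
  have hw : (1 + u * Complex.I : ℂ) ≠ 0 := by
    intro h; simpa using congrArg Complex.re h
  have hwre : 0 < (1 + u * Complex.I : ℂ).re := by simp
  have hx' : (x : ℂ) ≠ 0 := by exact_mod_cast hx.ne'
  have hpi : (Real.pi : ℂ) ≠ 0 := by exact_mod_cast Real.pi_ne_zero
  have hI := Complex.I_ne_zero
  have h := ModularForm.eta_comp_eq_csqrt_I_inv (I_mul_div_two_pi_mem hx u)
  simp only [Function.comp, Pi.smul_apply, Pi.mul_apply, smul_eq_mul,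
    eta_eq_exp_mul_eulerProd] at h
  have e1 : 2 * Real.pi * Complex.I *
      (Complex.I * ((x : ℂ) * (1 + u * Complex.I)) / (2 * Real.pi)) =
      -((x : ℂ) * (1 + u * Complex.I)) := by
    field_simp
    rw [Complex.I_sq]
    ring
  have e2 : 2 * Real.pi * Complex.I *
      (-1 / (Complex.I * ((x : ℂ) * (1 + u * Complex.I)) / (2 * Real.pi))) =
      -(4 * Real.pi ^ 2 / ((x : ℂ) * (1 + u * Complex.I))) := by
    field_simp
    norm_num
  have e3 : Complex.I * ((x : ℂ) * (1 + u * Complex.I)) / (2 * Real.pi) =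
      ((x / (2 * Real.pi) : ℝ) : ℂ) * (Complex.I * (1 + u * Complex.I)) := by
    push_cast
    ring
  rw [e1, e2, e3, sqrt_ofReal_mul_I_mul (by positivity) hwre] at h
  have hsI : Complex.sqrt Complex.I ≠ 0 := by
    rw [sqrt_eq_exp hI]; exact Complex.exp_ne_zero _
  have hF1 : eulerProd (Complex.exp (-((x : ℂ) * (1 + u * Complex.I)))) ≠ 0 :=
    eulerProd_ne_zero (norm_exp_neg_lt_one (by simpa using hx))
  have hF2 : eulerProd (Complex.exp (-(4 * Real.pi ^ 2 / ((x : ℂ) * (1 + u * Complex.I))))) ≠ 0 :=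
    eulerProd_ne_zero (norm_exp_neg_lt_one (by rw [re_four_pi_sq_div hx]; positivity))
  have e4 : Complex.exp (Real.pi ^ 2 / (6 * ((x : ℂ) * (1 + u * Complex.I)))) *
      Complex.exp (-(4 * Real.pi ^ 2 / ((x : ℂ) * (1 + u * Complex.I))) / 24) = 1 := by
    rw [← Complex.exp_add, ← Complex.exp_zero]
    congr 1
    field_simp
    ring
  have e5 : -((x : ℂ) * (1 + u * Complex.I) / 24) = -((x : ℂ) * (1 + u * Complex.I)) / 24 := by
    ring
  rw [e5]
  generalize eulerProd (Complex.exp (-((x : ℂ) * (1 + u * Complex.I)))) = F1 at *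
  generalize eulerProd (Complex.exp (-(4 * Real.pi ^ 2 / ((x : ℂ) * (1 + u * Complex.I))))) = F2
    at *
  generalize Complex.exp (-(4 * Real.pi ^ 2 / ((x : ℂ) * (1 + u * Complex.I))) / 24) = E2 at *
  have h' : E2 * F2 = Real.sqrt (x / (2 * Real.pi)) * Complex.sqrt (1 + u * Complex.I) *
        Complex.exp (-((x : ℂ) * (1 + u * Complex.I)) / 24) * F1 := by
    rw [h]
    field_simp
  refine (eq_inv_of_mul_eq_one_left ?_).symm
  calc _ = Complex.exp (Real.pi ^ 2 / (6 * ((x : ℂ) * (1 + u * Complex.I)))) * F2⁻¹ *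
        (Real.sqrt (x / (2 * Real.pi)) * Complex.sqrt (1 + u * Complex.I) *
        Complex.exp (-((x : ℂ) * (1 + u * Complex.I)) / 24) * F1) := by ring
    _ = Complex.exp (Real.pi ^ 2 / (6 * ((x : ℂ) * (1 + u * Complex.I)))) * E2 * (F2⁻¹ * F2) := by
        rw [← h']; ring
    _ = 1 := by rw [e4, inv_mul_cancel₀ hF2, one_mul]

/-- Near the origin the generating function of the partitions is `1 + O(w)`. -/
lemma norm_inv_eulerProd_sub_one_le :
    ∃ C : ℝ, 0 < C ∧ ∀ w : ℂ, ‖w‖ ≤ 1 / 2 → ‖(eulerProd w)⁻¹ - 1‖ ≤ C * ‖w‖ := by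
  have hs : Summable fun n ↦ (Fintype.card (Nat.Partition (n + 1)) : ℝ) * (1 / 2) ^ (n + 1) :=
    (summable_nat_add_iff 1).mpr (summable_card_partition (by norm_num) (by norm_num))
  refine ⟨2 * (∑' n, (Fintype.card (Nat.Partition (n + 1)) : ℝ) * (1 / 2) ^ (n + 1)) + 1,
    by positivity, fun w hw ↦ ?_⟩
  have h := hasSum_card_partition (q := w) (by linarith)
  have h0 : (eulerProd w)⁻¹ - 1 =
      ∑' n, (Fintype.card (Nat.Partition (n + 1)) : ℂ) * w ^ (n + 1) := by
    rw [← h.tsum_eq, h.summable.tsum_eq_zero_add]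
    simp
  have hb : ∀ n, ‖(Fintype.card (Nat.Partition (n + 1)) : ℂ) * w ^ (n + 1)‖ ≤
      2 * ‖w‖ * ((Fintype.card (Nat.Partition (n + 1)) : ℝ) * (1 / 2) ^ (n + 1)) := by
    intro n
    rw [norm_mul, norm_pow, Complex.norm_natCast, pow_succ, pow_succ]
    have : ‖w‖ ^ n ≤ (1 / 2) ^ n := pow_le_pow_left₀ (norm_nonneg _) hw n
    calc (Fintype.card (Nat.Partition (n + 1)) : ℝ) * (‖w‖ ^ n * ‖w‖)
        ≤ (Fintype.card (Nat.Partition (n + 1)) : ℝ) * ((1 / 2) ^ n * ‖w‖) := by gcongr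
      _ = _ := by ring
  rw [h0]
  have := tsum_of_norm_bounded (hs.mul_left (2 * ‖w‖)).hasSum hb
  rw [tsum_mul_left] at this
  nlinarith [norm_nonneg w]

/-! ### The major arc -/

/-- Factors of the form `1 + O(t)` with bounded `t` multiply to `1 + O(t)`. -/
lemma norm_mul_sub_one_le {a b : ℂ} {A B t : ℝ} (hB : 0 ≤ B)
    (ht2 : t ≤ 2) (ha : ‖a - 1‖ ≤ A * t) (hb : ‖b - 1‖ ≤ B * t) :
    ‖a * b - 1‖ ≤ (A + B + 2 * A * B) * t := by
  have h : a * b - 1 = (a - 1) * (b - 1) + (a - 1) + (b - 1) := by ring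
  have h1 : ‖(a - 1) * (b - 1)‖ ≤ (A * t) * (B * t) := by
    rw [norm_mul]
    gcongr
    exact (norm_nonneg _).trans ha
  have hAt : 0 ≤ A * t := (norm_nonneg _).trans ha
  have h2 : (A * t) * (B * t) ≤ (A * t) * (B * 2) := by gcongr
  calc ‖a * b - 1‖ ≤ ‖(a - 1) * (b - 1)‖ + ‖a - 1‖ + ‖b - 1‖ := by
        rw [h]; exact norm_add₃_le
    _ ≤ (A * t) * (B * 2) + A * t + B * t := by linarith
    _ = _ := by ring

lemma norm_sqrt_one_add_mul_I_sub_one_le (u : ℝ) :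
    ‖Complex.sqrt (1 + u * Complex.I) - 1‖ ≤ |u| := by
  have hsq : Complex.sqrt (1 + u * Complex.I) ^ 2 = 1 + u * Complex.I := by
    rw [Complex.sqrt, ← Complex.cpow_nat_mul]
    norm_num
  have hre : 0 ≤ (Complex.sqrt (1 + u * Complex.I)).re := by
    rw [Complex.sqrt, Complex.cpow_inv_two_re]
    exact Real.sqrt_nonneg _
  generalize Complex.sqrt (1 + u * Complex.I) = s at *
  have h1 : (s - 1) * (s + 1) = u * Complex.I := by linear_combination hsq
  have h2 : ‖s - 1‖ * ‖s + 1‖ = |u| := by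
    rw [← norm_mul, h1]; simp
  have h3 : 1 ≤ ‖s + 1‖ := by
    have := Complex.re_le_norm (s + 1)
    simp at this
    linarith
  nlinarith [norm_nonneg (s - 1)]

lemma norm_one_add_mul_I_le {u : ℝ} (hu : |u| ≤ 1) : ‖(1 + u * Complex.I : ℂ)‖ ≤ 2 := by
  calc ‖(1 + u * Complex.I : ℂ)‖ ≤ ‖(1 : ℂ)‖ + ‖u * Complex.I‖ := norm_add_le _ _
    _ ≤ 2 := by simp; linarith

lemma Real.exp_neg_le_inv {t : ℝ} (ht : 0 < t) : Real.exp (-t) ≤ 1 / t := by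
  rw [Real.exp_neg, ← one_div]
  exact one_div_le_one_div_of_le ht (by linarith [Real.add_one_le_exp t])

/-- The generating function of the first differences of the partition function close to `q = 1`:
with `τ = x (1 + i u)` it is `τ √(τ / 2π) exp (π² / (6 τ)) (1 + O(x))`, and replacing `τ` by `x` in
the algebraic factor costs a further relative error `O(|u|)`. Both errors are collected in `A`. -/
theorem exists_major_arc_factor :
    ∃ C : ℝ, 0 < C ∧ ∀ x : ℝ, 0 < x → x ≤ 1 / 2 → ∀ u : ℝ, |u| ≤ 1 → ∃ A : ℂ,
      ‖A - 1‖ ≤ C * (|u| + x) ∧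
      (1 - Complex.exp (-((x : ℂ) * (1 + u * Complex.I)))) *
        (eulerProd (Complex.exp (-((x : ℂ) * (1 + u * Complex.I)))))⁻¹ =
      (x * Real.sqrt (x / (2 * Real.pi)) : ℝ) * A *
        Complex.exp (Real.pi ^ 2 / (6 * ((x : ℂ) * (1 + u * Complex.I)))) := by
  obtain ⟨C₀, hC₀, hF⟩ := norm_inv_eulerProd_sub_one_le
  obtain ⟨C₁, hC₁, h1⟩ : ∃ C₁, (0 : ℝ) < C₁ ∧ (4 + 1 + 2 * 4 * 1 : ℝ) = C₁ := ⟨_, by norm_num, rfl⟩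
  obtain ⟨C₂, hC₂, h2⟩ : ∃ C₂, (0 : ℝ) < C₂ ∧ (C₁ + 1 + 2 * C₁ * 1 : ℝ) = C₂ :=
    ⟨_, by positivity, rfl⟩
  refine ⟨C₂ + C₀ + 2 * C₂ * C₀, by positivity, fun x hx hx2 u hu ↦ ?_⟩
  have hx' : (x : ℂ) ≠ 0 := by exact_mod_cast hx.ne'
  have hw := norm_one_add_mul_I_le hu
  set τ : ℂ := (x : ℂ) * (1 + u * Complex.I) with hτ
  have hτn : ‖τ‖ ≤ 2 * x := by
    rw [hτ, norm_mul, Complex.norm_real, Real.norm_of_nonneg hx.le]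
    nlinarith
  have hτ1 : ‖-τ‖ ≤ 1 := by rw [norm_neg]; linarith
  have ht2 : |u| + x ≤ 2 := by linarith
  refine ⟨(1 - Complex.exp (-τ)) / x * Complex.sqrt (1 + u * Complex.I) *
    Complex.exp (-(τ / 24)) * (eulerProd (Complex.exp (-(4 * Real.pi ^ 2 / τ))))⁻¹, ?_, ?_⟩
  · have b1 : ‖(1 - Complex.exp (-τ)) / x - 1‖ ≤ 4 * (|u| + x) := by
      have e : (1 - Complex.exp (-τ)) / x - 1 =
          u * Complex.I - (Complex.exp (-τ) - 1 - (-τ)) / x := by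
        rw [hτ]; field_simp; ring
      have h3 := Complex.norm_exp_sub_one_sub_id_le hτ1
      have h4 : ‖(Complex.exp (-τ) - 1 - (-τ)) / x‖ ≤ 4 * x := by
        rw [norm_div, Complex.norm_real, Real.norm_of_nonneg hx.le, div_le_iff₀ hx]
        rw [norm_neg] at h3
        nlinarith [norm_nonneg τ]
      calc _ ≤ ‖(u * Complex.I : ℂ)‖ + ‖(Complex.exp (-τ) - 1 - (-τ)) / x‖ := by
            rw [e]; exact norm_sub_le _ _
        _ ≤ |u| + 4 * x := by simpa using h4
        _ ≤ _ := by linarith [abs_nonneg u]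
    have b2 : ‖Complex.sqrt (1 + u * Complex.I) - 1‖ ≤ 1 * (|u| + x) :=
      (norm_sqrt_one_add_mul_I_sub_one_le u).trans (by linarith)
    have b3 : ‖Complex.exp (-(τ / 24)) - 1‖ ≤ 1 * (|u| + x) := by
      have h5 : ‖-(τ / 24)‖ ≤ 2 * x / 24 := by
        rw [norm_neg, norm_div]; norm_num; linarith
      have := Complex.norm_exp_sub_one_le (x := -(τ / 24)) (by linarith)
      linarith [abs_nonneg u]
    have b4 : ‖(eulerProd (Complex.exp (-(4 * Real.pi ^ 2 / τ))))⁻¹ - 1‖ ≤ C₀ * (|u| + x) := by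
      have h6 : ‖Complex.exp (-(4 * Real.pi ^ 2 / τ))‖ ≤ x := by
        rw [Complex.norm_exp, Complex.neg_re, hτ, re_four_pi_sq_div hx]
        refine (Real.exp_neg_le_inv (by positivity)).trans ?_
        rw [one_div_div, div_le_iff₀ (by positivity)]
        have hu2 : u ^ 2 ≤ 1 := by rw [← sq_abs]; nlinarith [abs_nonneg u]
        have : (9 : ℝ) ≤ Real.pi ^ 2 := by nlinarith [Real.pi_gt_three]
        nlinarith
      exact (hF _ (h6.trans hx2)).trans (by gcongr; linarith [abs_nonneg u])
    have c1 := norm_mul_sub_one_le (by norm_num) ht2 b1 b2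
    rw [h1] at c1
    have c2 := norm_mul_sub_one_le (by norm_num) ht2 c1 b3
    rw [h2] at c2
    exact norm_mul_sub_one_le hC₀.le ht2 c2 b4
  · rw [inv_eulerProd_exp_neg hx u, ← hτ]
    push_cast
    field_simp

/-! ### The minor arc -/

/-- The elementary inequality behind the minor arc estimate: the function
`-log (1 - z) - z` has nonnegative Taylor coefficients. -/
lemma norm_inv_one_sub_le {z : ℂ} (hz : ‖z‖ < 1) :
    ‖(1 - z)⁻¹‖ ≤ (1 - ‖z‖)⁻¹ * Real.exp (z.re - ‖z‖) := by
  have h1 := Complex.hasSum_re (Complex.hasSum_taylorSeries_neg_log hz)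
  have h2 := Real.hasSum_pow_div_log_of_abs_lt_one (x := ‖z‖) (by simpa using hz)
  have hz1 : 1 - z ≠ 0 := by
    intro h
    rw [← sub_eq_zero.mp h] at hz
    simp at hz
  have hpos : 0 < ‖1 - z‖ := norm_pos_iff.mpr hz1
  have hpos' : 0 < 1 - ‖z‖ := by linarith
  -- Both series start with their quadratic terms once the linear ones are split off.
  have h1' := (hasSum_nat_add_iff' 2).mpr h1
  have h2' := (hasSum_nat_add_iff' 1).mpr h2
  have hle := hasSum_le (fun n ↦ ?_) h1' h2'
  · simp [Finset.sum_range_succ, Complex.log_re] at hle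
    rw [norm_inv, ← Real.exp_log hpos, ← Real.exp_log hpos', ← Real.exp_neg, ← Real.exp_neg,
      ← Real.exp_add, Real.exp_le_exp]
    linarith
  · refine (Complex.re_le_norm _).trans ?_
    rw [norm_div, norm_pow, Complex.norm_natCast]
    push_cast
    rw [show ((n : ℝ) + 2) = n + 1 + 1 by ring]

lemma norm_inv_eulerProd_le {q : ℂ} (hq : ‖q‖ < 1) :
    ‖(eulerProd q)⁻¹‖ ≤ ‖(eulerProd (‖q‖ : ℂ))⁻¹‖ *
      Real.exp (((1 - q)⁻¹).re - (1 - ‖q‖)⁻¹) := by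
  have hr : ‖(‖q‖ : ℂ)‖ < 1 := by simpa using hq
  have hsum : HasSum (fun n ↦ (q ^ n).re - ‖q‖ ^ n) (((1 - q)⁻¹).re - (1 - ‖q‖)⁻¹) :=
    (Complex.hasSum_re (hasSum_geometric_of_norm_lt_one hq)).sub
      (hasSum_geometric_of_lt_one (norm_nonneg q) hq)
  -- The shift by one drops the term `n = 0`, which vanishes.
  have hlim := hsum.tendsto_sum_nat.comp (Filter.tendsto_add_atTop_nat 1)
  refine le_of_tendsto_of_tendsto' (tendsto_prod_inv hq).norm
    ((tendsto_prod_inv hr).norm.mul ((Real.continuous_exp.tendsto _).comp hlim)) fun N ↦ ?_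
  simp only [Function.comp, Finset.sum_range_succ', pow_zero, Complex.one_re, sub_self, add_zero,
    Real.exp_sum, norm_prod, ← Finset.prod_mul_distrib]
  refine Finset.prod_le_prod (fun i _ ↦ norm_nonneg _) fun i _ ↦ ?_
  have hi : ‖q ^ (i + 1)‖ < 1 := by
    rw [norm_pow]; exact pow_lt_one₀ (norm_nonneg _) hq (by omega)
  have h := norm_inv_one_sub_le hi
  have e : ‖(1 - (‖q‖ : ℂ) ^ (i + 1))⁻¹‖ = (1 - ‖q ^ (i + 1)‖)⁻¹ := by
    rw [norm_pow] at hi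
    rw [norm_pow, norm_inv, ← Complex.ofReal_pow, ← Complex.ofReal_one, ← Complex.ofReal_sub,
      Complex.norm_real, Real.norm_of_nonneg (by linarith)]
  rw [e, ← norm_pow]
  exact h

/-- Away from the real axis `1 / |1 - q|` is smaller than `1 / (1 - |q|)` by a constant factor. -/
lemma inv_one_sub_exp_re_le {x y : ℝ} (hx : 0 < x) (hx2 : x ≤ 1 / 2) (hxy : x ≤ |y|)
    (hy : |y| ≤ Real.pi) :
    ((1 - Complex.exp (-(x + y * Complex.I)))⁻¹).re - (1 - Real.exp (-x))⁻¹ ≤ -(1 / (20 * x)) := by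
  set r := Real.exp (-x) with hr
  have hr1 : 1 - r ≤ x := by linarith [Real.add_one_le_exp (-x)]
  have hr2 : 1 / 2 ≤ r := by linarith [Real.add_one_le_exp (-x)]
  have hr3 : 0 < 1 - r := by
    have : r < 1 := by rw [hr, Real.exp_lt_one_iff]; linarith
    linarith
  have hcos := Real.cos_le_one_sub_mul_cos_sq hy
  have hpi : Real.pi ^ 2 ≤ 10 := by nlinarith [Real.pi_lt_d2, Real.pi_pos]
  have hpi0 : 0 < Real.pi ^ 2 := by positivity
  have hy2 : x ^ 2 ≤ y ^ 2 := by rw [← sq_abs y]; gcongr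
  have h5 : 1 / 5 * x ^ 2 ≤ 2 / Real.pi ^ 2 * y ^ 2 := by
    have : 1 / 5 ≤ 2 / Real.pi ^ 2 := by rw [div_le_div_iff₀ (by norm_num) hpi0]; linarith
    gcongr
  have hnorm : ‖1 - Complex.exp (-(x + y * Complex.I))‖ ^ 2 =
      (1 - r) ^ 2 + 2 * r * (1 - Real.cos y) := by
    have e : 1 - Complex.exp (-(x + y * Complex.I)) =
        (1 - r * Real.cos y : ℝ) + (r * Real.sin y : ℝ) * Complex.I := by
      rw [neg_add, Complex.exp_add, hr, ← neg_mul, ← Complex.ofReal_neg, Complex.exp_mul_I,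
        ← Complex.ofReal_neg, ← Complex.ofReal_cos, ← Complex.ofReal_sin, ← Complex.ofReal_exp,
        Real.cos_neg, Real.sin_neg]
      push_cast
      ring
    rw [e, ← Complex.normSq_eq_norm_sq, Complex.normSq_add_mul_I]
    linear_combination r ^ 2 * Real.sin_sq_add_cos_sq y
  -- The constant `20 / 19` leaves a gain of `1 / 20` in the inverse.
  have hge : (20 / 19 * (1 - r)) ^ 2 ≤ ‖1 - Complex.exp (-(x + y * Complex.I))‖ ^ 2 := by
    rw [hnorm]
    have h6 : 1 / 5 * (1 - r) ^ 2 ≤ 1 - Real.cos y := by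
      have : (1 - r) ^ 2 ≤ x ^ 2 := by gcongr
      linarith
    nlinarith [sq_nonneg (1 - r)]
  have hge' : 20 / 19 * (1 - r) ≤ ‖1 - Complex.exp (-(x + y * Complex.I))‖ :=
    (sq_le_sq₀ (by positivity) (norm_nonneg _)).mp hge
  have h7 : ((1 - Complex.exp (-(x + y * Complex.I)))⁻¹).re ≤ 19 / 20 * (1 - r)⁻¹ := by
    refine (Complex.re_le_norm _).trans ?_
    rw [norm_inv]
    calc _ ≤ (20 / 19 * (1 - r))⁻¹ := inv_anti₀ (by positivity) hge'
      _ = _ := by rw [mul_inv]; norm_num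
  have h8 : 1 / x ≤ (1 - r)⁻¹ := by rw [one_div]; exact inv_anti₀ hr3 hr1
  have h9 : 1 / (20 * x) = 1 / 20 * (1 / x) := by field_simp
  rw [h9]
  linarith

/-- On the minor arc the generating function is exponentially smaller than at the real point. -/
theorem exists_minor_arc_bound :
    ∃ C : ℝ, 0 < C ∧ ∀ x : ℝ, 0 < x → x ≤ 1 / 2 → ∀ y : ℝ, x ≤ |y| → |y| ≤ Real.pi →
      ‖(1 - Complex.exp (-(x + y * Complex.I))) *
        (eulerProd (Complex.exp (-(x + y * Complex.I))))⁻¹‖ ≤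
      C * Real.exp (Real.pi ^ 2 / (6 * x)) * Real.exp (-(1 / (20 * x))) := by
  obtain ⟨C₀, hC₀, hF⟩ := norm_inv_eulerProd_sub_one_le
  refine ⟨2 * (1 + C₀), by positivity, fun x hx hx2 y hxy hy ↦ ?_⟩
  have hnorm : ‖Complex.exp (-(x + y * Complex.I))‖ = Real.exp (-x) := by
    rw [Complex.norm_exp]; simp
  have hlt : ‖Complex.exp (-(x + y * Complex.I))‖ < 1 := by
    rw [hnorm, Real.exp_lt_one_iff]; linarith
  have h1 : ‖1 - Complex.exp (-(x + y * Complex.I))‖ ≤ 2 :=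
    (norm_sub_le _ _).trans (by rw [norm_one]; linarith)
  have h2 := norm_inv_eulerProd_le hlt
  have h3 := inv_one_sub_exp_re_le hx hx2 hxy hy
  rw [hnorm] at h2
  have h4 : ‖(eulerProd (Real.exp (-x) : ℂ))⁻¹‖ ≤ (1 + C₀) * Real.exp (Real.pi ^ 2 / (6 * x)) := by
    have h := inv_eulerProd_exp_neg hx 0
    simp only [Complex.ofReal_zero, zero_mul, add_zero, mul_one, Complex.sqrt_one] at h
    rw [Complex.ofReal_exp, Complex.ofReal_neg, h, norm_mul, norm_mul, norm_mul]
    have hpi0 := Real.pi_gt_three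
    have a1 : ‖(Real.sqrt (x / (2 * Real.pi)) : ℂ)‖ ≤ 1 := by
      rw [Complex.norm_real, Real.norm_of_nonneg (Real.sqrt_nonneg _)]
      rw [Real.sqrt_le_one]
      rw [div_le_one (by positivity)]
      linarith
    have a2 : ‖Complex.exp (-((x : ℂ) / 24))‖ ≤ 1 := by
      rw [Complex.norm_exp, Real.exp_le_one_iff]
      have : (-((x : ℂ) / 24)).re = -(x / 24) := by simp
      rw [this]; linarith
    have a3 : ‖(eulerProd (Complex.exp (-(4 * Real.pi ^ 2 / (x : ℂ)))))⁻¹‖ ≤ 1 + C₀ := by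
      have h6 : ‖Complex.exp (-(4 * Real.pi ^ 2 / (x : ℂ)))‖ ≤ 1 / 2 := by
        have := re_four_pi_sq_div hx 0
        simp only [Complex.ofReal_zero, zero_mul, add_zero, mul_one, ne_eq, OfNat.ofNat_ne_zero,
          not_false_eq_true, zero_pow] at this
        rw [Complex.norm_exp, Complex.neg_re, this]
        refine (Real.exp_neg_le_inv (by positivity)).trans ?_
        rw [one_div_div, div_le_iff₀ (by positivity)]
        nlinarith
      have h7 := hF _ h6
      have h8 := norm_sub_norm_le
        ((eulerProd (Complex.exp (-(4 * Real.pi ^ 2 / (x : ℂ)))))⁻¹) 1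
      rw [norm_one] at h8
      nlinarith
    have a4 : ‖Complex.exp (Real.pi ^ 2 / (6 * (x : ℂ)))‖ = Real.exp (Real.pi ^ 2 / (6 * x)) := by
      rw [Complex.norm_exp]
      congr 1
      have : (Real.pi ^ 2 / (6 * (x : ℂ))) = ((Real.pi ^ 2 / (6 * x) : ℝ) : ℂ) := by push_cast; rfl
      rw [this, Complex.ofReal_re]
    rw [a4]
    gcongr
    calc _ ≤ 1 * 1 * (1 + C₀) := by gcongr
      _ = _ := by ring
  calc _ ≤ 2 * (((1 + C₀) * Real.exp (Real.pi ^ 2 / (6 * x))) * Real.exp (-(1 / (20 * x)))) := by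
        rw [norm_mul]
        gcongr
        refine h2.trans ?_
        gcongr
    _ = _ := by ring

/-! ### The saddle point integral -/

lemma norm_exp_sub_one_le_norm {z : ℂ} (hz : z.re ≤ 0) : ‖Complex.exp z - 1‖ ≤ ‖z‖ := by
  have h := (convex_halfSpace_re_le (0 : ℝ)).norm_image_sub_le_of_norm_hasDerivWithin_le
    (f := Complex.exp) (f' := Complex.exp) (C := 1) (x := 0) (y := z)
    (fun w _ ↦ (Complex.hasDerivAt_exp w).hasDerivWithinAt)
    (fun w hw ↦ by rw [Complex.norm_exp, Real.exp_le_one_iff]; exact hw)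
    (by simp) hz
  simpa using h

lemma mul_exp_neg_div_four_le (t : ℝ) : t * Real.exp (-t / 4) ≤ 4 := by
  have h : t / 4 ≤ Real.exp (t / 4) := by linarith [Real.add_one_le_exp (t / 4)]
  rw [neg_div, Real.exp_neg, ← div_eq_mul_inv, div_le_iff₀ (Real.exp_pos _)]
  linarith

/-- On `|u| ≤ 1` the integrand at the saddle point is the Gaussian `exp (-l u²)` up to an error that
is linear in `u` times a wider Gaussian, plus `O(1 / l)`. -/
lemma norm_saddle_integrand_sub_gaussian_le {C x l u : ℝ} (hC : 0 ≤ C) (hl : 0 < l) (hx : x ≤ 2 / l)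
    (hu : |u| ≤ 1) {A : ℂ} (hA : ‖A - 1‖ ≤ C * (|u| + x)) :
    ‖A * Complex.exp (-(l * u ^ 2 / (1 + u * Complex.I))) - (Real.exp (-l * u ^ 2) : ℝ)‖ ≤
      (2 * C + 4) * (|u| * Real.exp (-(l / 4) * u ^ 2) + 1 / l) := by
  have hw : (1 + u * Complex.I : ℂ) ≠ 0 := by
    intro h; simpa using congrArg Complex.re h
  have hu2 : u ^ 2 ≤ 1 := by rw [← sq_abs]; nlinarith [abs_nonneg u]
  have hu0 : 0 ≤ u ^ 2 := sq_nonneg u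
  have hun : (1 + (u : ℂ) ^ 2) ≠ 0 := by
    have : (1 + u ^ 2 : ℝ) ≠ 0 := by positivity
    exact_mod_cast this
  have e1 : -(l * u ^ 2 / (1 + u * Complex.I) : ℂ) =
      ((-(l * u ^ 2 / (1 + u ^ 2)) : ℝ) : ℂ) + ((l * u ^ 3 / (1 + u ^ 2) : ℝ) : ℂ) * Complex.I := by
    push_cast
    field_simp
    linear_combination (-(l : ℂ) * u ^ 4) * Complex.I_sq
  have e2 : -(l * u ^ 2 : ℂ) - -(l * u ^ 2 / (1 + u * Complex.I)) =
      -(l * u ^ 3 * Complex.I / (1 + u * Complex.I)) := by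
    field_simp
    ring
  have hre : ‖Complex.exp (-(l * u ^ 2 / (1 + u * Complex.I)))‖ ≤ Real.exp (-(l / 2) * u ^ 2) := by
    rw [Complex.norm_exp, e1]
    simp only [Complex.add_re, Complex.ofReal_re, Complex.mul_re, Complex.I_re, mul_zero,
      Complex.ofReal_im, Complex.I_im, mul_one, sub_self, add_zero]
    rw [Real.exp_le_exp, neg_mul, neg_le_neg_iff, le_div_iff₀ (by positivity)]
    have : 0 ≤ l * u ^ 2 := by positivity
    nlinarith
  have hw1 : 1 ≤ ‖(1 + u * Complex.I : ℂ)‖ := by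
    have := Complex.re_le_norm (1 + u * Complex.I)
    simpa using this
  have hsecond : ‖Complex.exp (-(l * u ^ 2 : ℂ) - -(l * u ^ 2 / (1 + u * Complex.I))) - 1‖ ≤
      l * u ^ 2 * |u| := by
    refine (norm_exp_sub_one_le_norm ?_).trans ?_
    · rw [e1, Complex.sub_re, show (-(l * u ^ 2 : ℂ)) = ((-(l * u ^ 2) : ℝ) : ℂ) by push_cast; rfl]
      simp only [Complex.add_re, Complex.ofReal_re, Complex.mul_re, Complex.I_re, mul_zero,
        Complex.ofReal_im, Complex.I_im, mul_one, sub_self, add_zero]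
      have : l * u ^ 2 / (1 + u ^ 2) ≤ l * u ^ 2 := div_le_self (by positivity) (by linarith)
      linarith
    · rw [e2, norm_neg, norm_div]
      refine (div_le_self (norm_nonneg _) hw1).trans ?_
      have : ‖(l * u ^ 3 * Complex.I : ℂ)‖ = l * (|u| ^ 3) := by
        simp [abs_of_pos hl]
      rw [this, ← sq_abs]
      exact le_of_eq (by ring)
  -- Half of the Gaussian decay absorbs the factor `l * u ^ 2` coming from the
  -- cubic term.
  have hhalf : Real.exp (-(l / 2) * u ^ 2) =
      Real.exp (-(l / 4) * u ^ 2) * Real.exp (-(l * u ^ 2) / 4) := by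
    rw [← Real.exp_add]; congr 1; ring
  have hq1 : Real.exp (-(l / 4) * u ^ 2) ≤ 1 := by
    rw [Real.exp_le_one_iff]; nlinarith
  have hq2 : Real.exp (-(l * u ^ 2) / 4) ≤ 1 := by
    rw [Real.exp_le_one_iff]; nlinarith
  have hq3 := mul_exp_neg_div_four_le (l * u ^ 2)
  have split : A * Complex.exp (-(l * u ^ 2 / (1 + u * Complex.I))) -
      (Real.exp (-l * u ^ 2) : ℝ) =
      (A - 1) * Complex.exp (-(l * u ^ 2 / (1 + u * Complex.I))) -
      Complex.exp (-(l * u ^ 2 / (1 + u * Complex.I))) *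
        (Complex.exp (-(l * u ^ 2 : ℂ) - -(l * u ^ 2 / (1 + u * Complex.I))) - 1) := by
    rw [mul_sub, ← Complex.exp_add]
    push_cast
    rw [show -(l * u ^ 2 / (1 + u * Complex.I) : ℂ) +
      (-(l * u ^ 2 : ℂ) - -(l * u ^ 2 / (1 + u * Complex.I))) = -l * u ^ 2 by ring]
    ring
  rw [split]
  refine (norm_sub_le _ _).trans ?_
  rw [norm_mul, norm_mul]
  have t1 : ‖A - 1‖ * ‖Complex.exp (-(l * u ^ 2 / (1 + u * Complex.I)))‖ ≤
      C * |u| * Real.exp (-(l / 4) * u ^ 2) + 2 * C * (1 / l) := by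
    calc _ ≤ (C * (|u| + 2 / l)) * Real.exp (-(l / 2) * u ^ 2) := by
          gcongr
          exact hA.trans (by gcongr)
      _ = C * |u| * (Real.exp (-(l / 4) * u ^ 2) * Real.exp (-(l * u ^ 2) / 4)) +
          2 * C * (1 / l) * (Real.exp (-(l / 4) * u ^ 2) * Real.exp (-(l * u ^ 2) / 4)) := by
          rw [hhalf]; ring
      _ ≤ C * |u| * (Real.exp (-(l / 4) * u ^ 2) * 1) + 2 * C * (1 / l) * (1 * 1) := by
          gcongr
      _ = _ := by ring
  have t2 : ‖Complex.exp (-(l * u ^ 2 / (1 + u * Complex.I)))‖ *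
      ‖Complex.exp (-(l * u ^ 2 : ℂ) - -(l * u ^ 2 / (1 + u * Complex.I))) - 1‖ ≤
      4 * (|u| * Real.exp (-(l / 4) * u ^ 2)) := by
    calc _ ≤ Real.exp (-(l / 2) * u ^ 2) * (l * u ^ 2 * |u|) := by gcongr
      _ = |u| * Real.exp (-(l / 4) * u ^ 2) * (l * u ^ 2 * Real.exp (-(l * u ^ 2) / 4)) := by
          rw [hhalf]; ring
      _ ≤ |u| * Real.exp (-(l / 4) * u ^ 2) * 4 := by gcongr
      _ = _ := by ring
  have : 0 ≤ C * (|u| * Real.exp (-(l / 4) * u ^ 2)) := by positivity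
  have : 0 < 1 / l := by positivity
  linarith

open MeasureTheory in
lemma integrable_abs_mul_exp {b : ℝ} (hb : 0 < b) :
    Integrable fun u : ℝ ↦ |u| * Real.exp (-b * u ^ 2) := by
  refine (integrable_mul_exp_neg_mul_sq hb).norm.congr (Filter.Eventually.of_forall fun u ↦ ?_)
  simp

open MeasureTheory in
lemma integral_abs_mul_exp {b : ℝ} (hb : 0 < b) :
    ∫ u : ℝ, |u| * Real.exp (-b * u ^ 2) = 1 / b := by
  have h1 := integral_comp_abs (f := fun u : ℝ ↦ u * Real.exp (-b * u ^ 2))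
  simp only [sq_abs] at h1
  have h2 := integral_mul_cexp_neg_mul_sq (b := (b : ℂ)) (by simpa using hb)
  have h3 : ∫ u : ℝ in Set.Ioi 0, u * Real.exp (-b * u ^ 2) = (2 * b)⁻¹ := by
    have : ((∫ u : ℝ in Set.Ioi 0, u * Real.exp (-b * u ^ 2) : ℝ) : ℂ) = (2 * b : ℂ)⁻¹ := by
      rw [← h2, ← integral_complex_ofReal]
      simp
    exact_mod_cast this
  rw [h1, h3]
  field_simp

open MeasureTheory in
/-- Laplace's method: an integrand on `[-1, 1]` that is Gaussian up to linear terms has integral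
`√(π / l) + O(1 / l)`. -/
lemma norm_integral_sub_sqrt_le {K : ℝ → ℂ} {C l : ℝ} (hC : 1 ≤ C) (hl : 0 < l)
    (hK : Continuous K)
    (h : ∀ u, |u| ≤ 1 → ‖K u - (Real.exp (-l * u ^ 2) : ℝ)‖ ≤
      C * (|u| * Real.exp (-(l / 4) * u ^ 2) + 1 / l)) :
    ‖(∫ u in (-1 : ℝ)..1, K u) - (Real.sqrt (Real.pi / l) : ℝ)‖ ≤ 6 * C / l := by
  have hg : Integrable fun u : ℝ ↦ ((Real.exp (-l * u ^ 2) : ℝ) : ℂ) :=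
    (integrable_exp_neg_mul_sq hl).ofReal
  have hKi : Integrable ((Set.Ioc (-1 : ℝ) 1).indicator K) := by
    rw [integrable_indicator_iff measurableSet_Ioc]
    exact (hK.integrableOn_Icc).mono_set Set.Ioc_subset_Icc_self
  have hgv : ∫ u : ℝ, ((Real.exp (-l * u ^ 2) : ℝ) : ℂ) = (Real.sqrt (Real.pi / l) : ℝ) := by
    rw [integral_complex_ofReal, integral_gaussian]
  have hci : Integrable ((Set.Ioc (-1 : ℝ) 1).indicator fun _ ↦ (1 / l : ℝ)) := by
    rw [integrable_indicator_iff measurableSet_Ioc]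
    exact integrableOn_const (by simp)
  have hb := integrable_abs_mul_exp (b := l / 4) (by positivity)
  rw [intervalIntegral.integral_of_le (by norm_num), ← integral_indicator measurableSet_Ioc, ← hgv,
    ← integral_sub hKi hg]
  refine (norm_integral_le_of_norm_le ((hb.add hci).const_mul C)
    (Filter.Eventually.of_forall fun u ↦ ?_)).trans ?_
  · by_cases hu : u ∈ Set.Ioc (-1 : ℝ) 1
    · simp only [Set.indicator_of_mem hu, Pi.add_apply]
      exact h u (abs_le.mpr ⟨hu.1.le, hu.2⟩)
    · -- Outside `[-1, 1]` the Gaussian is bounded by the same error term since `1 ≤ |u|`.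
      simp only [Set.indicator_of_notMem hu, Pi.add_apply, zero_sub, norm_neg, add_zero]
      have hu1 : 1 ≤ |u| := by
        by_contra! hlt
        exact hu ⟨(abs_lt.mp hlt).1, (abs_lt.mp hlt).2.le⟩
      rw [Complex.norm_real, Real.norm_of_nonneg (Real.exp_pos _).le]
      have h1 : Real.exp (-l * u ^ 2) ≤ Real.exp (-(l / 4) * u ^ 2) := by
        rw [Real.exp_le_exp]
        have : 0 ≤ l * u ^ 2 := by positivity
        nlinarith
      have h2 : Real.exp (-(l / 4) * u ^ 2) ≤ |u| * Real.exp (-(l / 4) * u ^ 2) :=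
        le_mul_of_one_le_left (Real.exp_pos _).le hu1
      have h3 : |u| * Real.exp (-(l / 4) * u ^ 2) ≤ C * (|u| * Real.exp (-(l / 4) * u ^ 2)) :=
        le_mul_of_one_le_left (by positivity) hC
      linarith
  · rw [integral_const_mul, integral_add' hb hci, integral_abs_mul_exp (by positivity),
      integral_indicator measurableSet_Ioc]
    simp
    apply le_of_eq
    field_simp
    norm_num

/-! ### Coefficient extraction -/

lemma integral_exp_int_mul_I (k : ℤ) :
    ∫ y in (-Real.pi)..Real.pi, Complex.exp (k * Complex.I * y) =
      if k = 0 then 2 * (Real.pi : ℂ) else 0 := by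
  split_ifs with hk
  · subst hk
    simp only [Int.cast_zero, zero_mul, Complex.exp_zero, intervalIntegral.integral_const]
    rw [Complex.real_smul]
    push_cast
    ring
  · have hc : (k : ℂ) * Complex.I ≠ 0 := mul_ne_zero (by exact_mod_cast hk) Complex.I_ne_zero
    rw [integral_exp_mul_complex hc, div_eq_zero_iff]
    left
    rw [sub_eq_zero, Complex.exp_eq_exp_iff_exists_int]
    refine ⟨k, ?_⟩
    push_cast
    ring

/-- Cauchy's formula for the partition numbers on the circle `|q| = exp (-x)`. -/
lemma integral_inv_eulerProd_mul_exp {x : ℝ} (hx : 0 < x) (n : ℕ) :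
    ∫ y in (-Real.pi)..Real.pi, (eulerProd (Complex.exp (-(x + y * Complex.I))))⁻¹ *
      Complex.exp (n * (x + y * Complex.I)) =
      2 * Real.pi * (Fintype.card (Nat.Partition n) : ℂ) := by
  have hr : Real.exp (-x) < 1 := by rw [Real.exp_lt_one_iff]; linarith
  have hs := (summable_card_partition (Real.exp_pos (-x)).le hr).mul_right (Real.exp (n * x))
  have hnorm : ∀ y : ℝ, ‖Complex.exp (-(x + y * Complex.I))‖ = Real.exp (-x) := by
    intro y; rw [Complex.norm_exp]; simp
  have h := intervalIntegral.hasSum_integral_of_dominated_convergence (μ := MeasureTheory.volume)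
    (a := -Real.pi) (b := Real.pi)
    (F := fun m y ↦ (Fintype.card (Nat.Partition m) : ℂ) *
      Complex.exp (-(x + y * Complex.I)) ^ m * Complex.exp (n * (x + y * Complex.I)))
    (f := fun y ↦ (eulerProd (Complex.exp (-(x + y * Complex.I))))⁻¹ *
      Complex.exp (n * (x + y * Complex.I)))
    (fun m _ ↦ (Fintype.card (Nat.Partition m) : ℝ) * Real.exp (-x) ^ m * Real.exp (n * x))
    (fun m ↦ (by fun_prop : Continuous fun y : ℝ ↦ (Fintype.card (Nat.Partition m) : ℂ) *
      Complex.exp (-(x + y * Complex.I)) ^ m *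
      Complex.exp (n * (x + y * Complex.I))).aestronglyMeasurable)
    (fun m ↦ Filter.Eventually.of_forall fun y _ ↦ by
      rw [norm_mul, norm_mul, norm_pow, hnorm, Complex.norm_natCast, Complex.norm_exp (n * _)]
      simp)
    (Filter.Eventually.of_forall fun y _ ↦ hs)
    intervalIntegrable_const
    (Filter.Eventually.of_forall fun y _ ↦
      (hasSum_card_partition (by rw [hnorm]; exact hr)).mul_right _)
  have h2 : ∀ m : ℕ, ∫ y in (-Real.pi)..Real.pi, (Fintype.card (Nat.Partition m) : ℂ) *
      Complex.exp (-(x + y * Complex.I)) ^ m * Complex.exp (n * (x + y * Complex.I)) =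
      if m = n then 2 * Real.pi * (Fintype.card (Nat.Partition n) : ℂ) else 0 := by
    intro m
    have e : ∀ y : ℝ, (Fintype.card (Nat.Partition m) : ℂ) *
        Complex.exp (-(x + y * Complex.I)) ^ m * Complex.exp (n * (x + y * Complex.I)) =
        (Fintype.card (Nat.Partition m) : ℂ) * Complex.exp (((n : ℝ) - m) * x) *
          Complex.exp (((n - m : ℤ) : ℂ) * Complex.I * y) := by
      intro y
      rw [mul_assoc, mul_assoc, ← Complex.exp_nat_mul, ← Complex.exp_add, ← Complex.exp_add]
      congr 2
      push_cast
      ring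
    simp only [e]
    rw [intervalIntegral.integral_const_mul, integral_exp_int_mul_I]
    by_cases hmn : m = n
    · subst hmn
      simp
      ring
    · rw [if_neg (by omega), if_neg hmn, mul_zero]
  simp only [h2] at h
  exact h.unique (hasSum_ite_eq n _)

lemma continuous_inv_eulerProd_exp {x : ℝ} (hx : 0 < x) :
    Continuous fun y : ℝ ↦ (eulerProd (Complex.exp (-(x + y * Complex.I))))⁻¹ := by
  have hr : Real.exp (-x) < 1 := by rw [Real.exp_lt_one_iff]; linarith
  have hnorm : ∀ y : ℝ, ‖Complex.exp (-(x + y * Complex.I))‖ = Real.exp (-x) := by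
    intro y; rw [Complex.norm_exp]; simp
  have e : (fun y : ℝ ↦ (eulerProd (Complex.exp (-(x + y * Complex.I))))⁻¹) = fun y : ℝ ↦
      ∑' m, (Fintype.card (Nat.Partition m) : ℂ) * Complex.exp (-(x + y * Complex.I)) ^ m := by
    ext y
    exact (hasSum_card_partition (by rw [hnorm]; exact hr)).tsum_eq.symm
  rw [e]
  refine continuous_tsum (fun m ↦ by fun_prop)
    (summable_card_partition (Real.exp_pos (-x)).le hr) fun m y ↦ ?_
  rw [norm_mul, norm_pow, hnorm, Complex.norm_natCast]

/-- The integrand in Cauchy's formula for `p(n) - p(n - 1)` at `q = exp (-(x + i y))`. -/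
noncomputable def diffIntegrand (n : ℕ) (x y : ℝ) : ℂ :=
  (1 - Complex.exp (-(x + y * Complex.I))) * (eulerProd (Complex.exp (-(x + y * Complex.I))))⁻¹ *
    Complex.exp (n * (x + y * Complex.I))

lemma continuous_diffIntegrand (n : ℕ) {x : ℝ} (hx : 0 < x) :
    Continuous (diffIntegrand n x) := by
  unfold diffIntegrand
  have := continuous_inv_eulerProd_exp hx
  fun_prop

lemma integral_diffIntegrand {x : ℝ} (hx : 0 < x) (n : ℕ) :
    ∫ y in (-Real.pi)..Real.pi, diffIntegrand (n + 1) x y =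
      2 * Real.pi * ((Fintype.card (Nat.Partition (n + 1)) : ℂ) -
        (Fintype.card (Nat.Partition n) : ℂ)) := by
  have hc := continuous_inv_eulerProd_exp hx
  rw [mul_sub, ← integral_inv_eulerProd_mul_exp hx, ← integral_inv_eulerProd_mul_exp hx,
    ← intervalIntegral.integral_sub]
  · refine intervalIntegral.integral_congr fun y _ ↦ ?_
    simp only [diffIntegrand]
    have : Complex.exp (n * (x + y * Complex.I)) = Complex.exp (-(x + y * Complex.I)) *
        Complex.exp ((n + 1 : ℕ) * (x + y * Complex.I)) := by
      rw [← Complex.exp_add]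
      congr 1
      push_cast
      ring
    rw [this]
    ring
  · exact (hc.mul (by fun_prop)).intervalIntegrable _ _
  · exact (hc.mul (by fun_prop)).intervalIntegrable _ _

/-! ### The first differences of the partition function -/

lemma exp_neg_one_div_le {x : ℝ} (hx : 0 < x) : Real.exp (-(1 / (20 * x))) ≤ 24 * (20 * x) ^ 4 := by
  have h := Real.pow_div_factorial_le_exp (1 / (20 * x)) (by positivity) 4
  rw [Real.exp_neg]
  calc _ ≤ ((1 / (20 * x)) ^ 4 / (Nat.factorial 4 : ℝ))⁻¹ := inv_anti₀ (by positivity) h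
    _ = _ := by
      norm_num [Nat.factorial]
      field_simp

/-- The asymptotic formula for the first differences in terms of the saddle point
`x = π / √(6 n)`; here `2 n x` is the value of the exponent at the saddle point. -/
lemma exists_norm_diff_card_partition_sub_le :
    ∃ C : ℝ, 0 < C ∧ ∀ (n : ℕ) (x : ℝ), 0 < x → x ≤ 1 / 2 →
      6 * ((n + 1 : ℕ) : ℝ) * x ^ 2 = Real.pi ^ 2 →
      |((Fintype.card (Nat.Partition (n + 1)) : ℝ) - (Fintype.card (Nat.Partition n) : ℝ)) -
        Real.sqrt 3 * x ^ 3 / (2 * Real.pi ^ 2) * Real.exp (2 * (((n + 1 : ℕ) : ℝ) * x))| ≤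
      C * (x ^ 3 * Real.sqrt x) * Real.exp (2 * (((n + 1 : ℕ) : ℝ) * x)) := by
  obtain ⟨C₁, hC₁, hmaj⟩ := exists_major_arc_factor
  obtain ⟨C₂, hC₂, hmin⟩ := exists_minor_arc_bound
  refine ⟨4 * (2 * C₁ + 4) + C₂ * (24 * 20 ^ 4), by positivity, fun n x hx hx2 hnx ↦ ?_⟩
  have hpi := Real.pi_gt_three
  have hpi2 : Real.pi ^ 2 ≤ 12 := by nlinarith [Real.pi_lt_d2, Real.pi_pos]
  have hpi9 : 9 ≤ Real.pi ^ 2 := by nlinarith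
  have hn0 : (0 : ℝ) < ((n + 1 : ℕ) : ℝ) := by positivity
  set l : ℝ := ((n + 1 : ℕ) : ℝ) * x with hl
  have hl0 : 0 < l := by positivity
  have hlx : 6 * l * x = Real.pi ^ 2 := by rw [hl, ← hnx]; ring
  have hlx' : Real.pi ^ 2 / (6 * x) = l := by rw [← hlx]; field_simp
  set P : ℝ := x * Real.sqrt (x / (2 * Real.pi)) with hP
  have hP0 : 0 < P := by positivity
  have hPl : 0 < P * Real.exp (2 * l) := by positivity
  set K : ℝ → ℂ := fun u ↦ diffIntegrand (n + 1) x (x * u) / (P * Real.exp (2 * l) : ℝ) with hK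
  have hKc : Continuous K := by
    have := continuous_diffIntegrand (n + 1) hx
    simp only [hK]
    fun_prop
  have hxl : x ≤ 2 / l := by rw [le_div_iff₀ hl0]; nlinarith
  -- At the saddle point `n τ + π² / (6 τ) = 2 l - l u² / (1 + i u)`.
  have hKb : ∀ u : ℝ, |u| ≤ 1 → ‖K u - (Real.exp (-l * u ^ 2) : ℝ)‖ ≤
      (2 * C₁ + 4) * (|u| * Real.exp (-(l / 4) * u ^ 2) + 1 / l) := by
    intro u hu
    obtain ⟨A, hA, hAe⟩ := hmaj x hx hx2 u hu
    have hKu : K u = A * Complex.exp (-(l * u ^ 2 / (1 + u * Complex.I))) := by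
      have hw : (1 + u * Complex.I : ℂ) ≠ 0 := by
        intro h; simpa using congrArg Complex.re h
      have hxc : (x : ℂ) ≠ 0 := by exact_mod_cast hx.ne'
      have e1 : (x : ℂ) + (x * u : ℝ) * Complex.I = x * (1 + u * Complex.I) := by
        push_cast; ring
      have e2 : Complex.exp (Real.pi ^ 2 / (6 * ((x : ℂ) * (1 + u * Complex.I)))) *
          Complex.exp ((n + 1 : ℕ) * ((x : ℂ) * (1 + u * Complex.I))) =
          Complex.exp (2 * l) * Complex.exp (-(l * u ^ 2 / (1 + u * Complex.I))) := by
        rw [← Complex.exp_add, ← Complex.exp_add]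
        congr 1
        have e3 : (Real.pi : ℂ) ^ 2 = 6 * l * x := by exact_mod_cast hlx.symm
        have e4 : ((n + 1 : ℕ) : ℂ) * x = l := by rw [hl]; push_cast; ring
        rw [← mul_assoc ((n + 1 : ℕ) : ℂ), e4, e3]
        field_simp
        linear_combination (l : ℂ) * (u : ℂ) ^ 2 * Complex.I_sq
      have hden : ((P * Real.exp (2 * l) : ℝ) : ℂ) ≠ 0 := by exact_mod_cast hPl.ne'
      simp only [hK]
      rw [div_eq_iff hden]
      simp only [diffIntegrand]
      rw [e1, hAe, mul_assoc, e2, ← hP]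
      push_cast
      ring
    rw [hKu]
    exact norm_saddle_integrand_sub_gaussian_le hC₁.le hl0 hxl hu hA
  have hKint := norm_integral_sub_sqrt_le (by linarith) hl0 hKc hKb
  have hDc := continuous_diffIntegrand (n + 1) hx
  have hii : ∀ a b : ℝ, IntervalIntegrable (diffIntegrand (n + 1) x) MeasureTheory.volume a b :=
    fun a b ↦ hDc.intervalIntegrable a b
  have hmid : ∫ y in (-x)..x, diffIntegrand (n + 1) x y =
      (x * P * Real.exp (2 * l) : ℝ) * ∫ u in (-1 : ℝ)..1, K u := by
    have h := intervalIntegral.smul_integral_comp_mul_left (a := -1) (b := 1)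
      (diffIntegrand (n + 1) x) x
    have hDK : ∀ u, diffIntegrand (n + 1) x (x * u) = (P * Real.exp (2 * l) : ℝ) * K u := by
      intro u
      have hden : ((P * Real.exp (2 * l) : ℝ) : ℂ) ≠ 0 := by exact_mod_cast hPl.ne'
      simp only [hK]
      field_simp
    simp only [hDK, intervalIntegral.integral_const_mul, mul_neg, mul_one, Complex.real_smul] at h
    rw [← h]
    push_cast
    ring
  have hB : ∀ y : ℝ, x ≤ |y| → |y| ≤ Real.pi → ‖diffIntegrand (n + 1) x y‖ ≤
      C₂ * (24 * (20 * x) ^ 4) * Real.exp (2 * l) := by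
    intro y h1 h2
    have h3 := hmin x hx hx2 y h1 h2
    rw [hlx'] at h3
    have h4 : ‖Complex.exp ((n + 1 : ℕ) * (x + y * Complex.I))‖ = Real.exp l := by
      rw [Complex.norm_exp, hl]
      congr 1
      simp
    calc _ ≤ C₂ * Real.exp l * Real.exp (-(1 / (20 * x))) * Real.exp l := by
          rw [diffIntegrand, norm_mul, h4]; gcongr
      _ ≤ C₂ * Real.exp l * (24 * (20 * x) ^ 4) * Real.exp l := by
          gcongr; exact exp_neg_one_div_le hx
      _ = _ := by rw [two_mul l, Real.exp_add]; ring
  have hxpi : x ≤ Real.pi := by linarith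
  have hleft : ‖∫ y in (-Real.pi)..(-x), diffIntegrand (n + 1) x y‖ ≤
      C₂ * (24 * (20 * x) ^ 4) * Real.exp (2 * l) * Real.pi := by
    refine (intervalIntegral.norm_integral_le_of_norm_le_const (fun y hy ↦ ?_)).trans
      (mul_le_mul_of_nonneg_left ?_ (by positivity))
    · rw [Set.uIoc_of_le (by linarith)] at hy
      have : |y| = -y := abs_of_nonpos (by linarith [hy.2])
      exact hB y (by linarith [hy.2]) (by linarith [hy.1])
    · rw [abs_of_nonneg (by linarith)]; linarith
  have hright : ‖∫ y in x..Real.pi, diffIntegrand (n + 1) x y‖ ≤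
      C₂ * (24 * (20 * x) ^ 4) * Real.exp (2 * l) * Real.pi := by
    refine (intervalIntegral.norm_integral_le_of_norm_le_const (fun y hy ↦ ?_)).trans
      (mul_le_mul_of_nonneg_left ?_ (by positivity))
    · rw [Set.uIoc_of_le hxpi] at hy
      have : |y| = y := abs_of_nonneg (by linarith [hy.1])
      exact hB y (by linarith [hy.1]) (by linarith [hy.2])
    · rw [abs_of_nonneg (by linarith)]; linarith
  have hsplit : ∫ y in (-Real.pi)..Real.pi, diffIntegrand (n + 1) x y =
      (∫ y in (-Real.pi)..(-x), diffIntegrand (n + 1) x y) +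
      (∫ y in (-x)..x, diffIntegrand (n + 1) x y) +
      ∫ y in x..Real.pi, diffIntegrand (n + 1) x y := by
    rw [intervalIntegral.integral_add_adjacent_intervals (hii _ _) (hii _ _),
      intervalIntegral.integral_add_adjacent_intervals (hii _ _) (hii _ _)]
  have hmain : x * P * Real.exp (2 * l) * Real.sqrt (Real.pi / l) =
      2 * Real.pi * (Real.sqrt 3 * x ^ 3 / (2 * Real.pi ^ 2) * Real.exp (2 * l)) := by
    have e1 : Real.sqrt (x / (2 * Real.pi)) * Real.sqrt (Real.pi / l) =
        Real.sqrt 3 * x / Real.pi := by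
      rw [← Real.sqrt_mul (by positivity)]
      have : x / (2 * Real.pi) * (Real.pi / l) = 3 * (x / Real.pi) ^ 2 := by
        rw [div_pow, ← hlx]; field_simp; norm_num
      rw [this, Real.sqrt_mul (by norm_num), Real.sqrt_sq (by positivity)]
      ring
    calc _ = x * x * Real.exp (2 * l) *
          (Real.sqrt (x / (2 * Real.pi)) * Real.sqrt (Real.pi / l)) := by rw [hP]; ring
      _ = _ := by rw [e1]; field_simp
  set E : ℝ := Real.exp (2 * l) with hE
  have hE0 : 0 < E := Real.exp_pos _
  set d : ℝ := (Fintype.card (Nat.Partition (n + 1)) : ℝ) - (Fintype.card (Nat.Partition n) : ℝ)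
    with hd
  set M : ℝ := Real.sqrt 3 * x ^ 3 / (2 * Real.pi ^ 2) * E with hM
  have hnorm : ‖((2 * Real.pi * (d - M) : ℝ) : ℂ)‖ ≤
      x * P * E * (6 * (2 * C₁ + 4) / l) + 2 * (C₂ * (24 * (20 * x) ^ 4) * E * Real.pi) := by
    have e : ((2 * Real.pi * (d - M) : ℝ) : ℂ) =
        (∫ y in (-Real.pi)..(-x), diffIntegrand (n + 1) x y) +
        (x * P * E : ℝ) * ((∫ u in (-1 : ℝ)..1, K u) - (Real.sqrt (Real.pi / l) : ℝ)) +
        ∫ y in x..Real.pi, diffIntegrand (n + 1) x y := by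
      have h1 := integral_diffIntegrand hx n
      rw [hsplit, hmid] at h1
      have h2 : ((x * P * E : ℝ) : ℂ) * (Real.sqrt (Real.pi / l) : ℝ) =
          ((2 * Real.pi * M : ℝ) : ℂ) := by rw [← hmain]; push_cast; ring
      rw [mul_sub ((x * P * E : ℝ) : ℂ), h2]
      have h3 : ((2 * Real.pi * (d - M) : ℝ) : ℂ) = 2 * Real.pi *
        ((Fintype.card (Nat.Partition (n + 1)) : ℂ) - (Fintype.card (Nat.Partition n) : ℂ)) -
        ((2 * Real.pi * M : ℝ) : ℂ) := by rw [hd]; push_cast; ring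
      rw [h3, ← h1]
      ring
    rw [e]
    refine norm_add₃_le.trans ?_
    rw [norm_mul, Complex.norm_real, Real.norm_of_nonneg (by positivity)]
    have : x * P * E * ‖(∫ u in (-1 : ℝ)..1, K u) - (Real.sqrt (Real.pi / l) : ℝ)‖ ≤
        x * P * E * (6 * (2 * C₁ + 4) / l) := by gcongr
    linarith
  rw [Complex.norm_real, Real.norm_eq_abs, abs_mul, abs_of_pos (by positivity)] at hnorm
  have hsq : Real.sqrt x * Real.sqrt x = x := Real.mul_self_sqrt hx.le
  have hsx0 := Real.sqrt_nonneg x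
  have hxs : x ≤ Real.sqrt x := by
    rw [Real.le_sqrt hx.le hx.le]; nlinarith
  have hPx : P ≤ x * Real.sqrt x := by
    rw [hP]
    gcongr
    exact div_le_self hx.le (by linarith)
  have b1 : x * P * E * (6 * (2 * C₁ + 4) / l) ≤ 4 * (2 * C₁ + 4) * (x ^ 3 * Real.sqrt x) * E := by
    have h6 : 6 / l ≤ 4 * x := by rw [div_le_iff₀ hl0]; nlinarith
    calc _ = x * P * E * ((6 / l) * (2 * C₁ + 4)) := by ring
      _ ≤ x * (x * Real.sqrt x) * E * ((4 * x) * (2 * C₁ + 4)) := by gcongr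
      _ = _ := by ring
  have b2 : C₂ * (24 * (20 * x) ^ 4) * E * Real.pi ≤
      Real.pi * (C₂ * (24 * 20 ^ 4) * (x ^ 3 * Real.sqrt x) * E) := by
    calc _ = Real.pi * (C₂ * (24 * 20 ^ 4) * (x ^ 3 * x) * E) := by ring
      _ ≤ _ := by gcongr
  have b3 : 0 ≤ 4 * (2 * C₁ + 4) * (x ^ 3 * Real.sqrt x) * E := by positivity
  have b4 : 2 * Real.pi * |d - M| ≤
      2 * Real.pi * ((4 * (2 * C₁ + 4) + C₂ * (24 * 20 ^ 4)) * (x ^ 3 * Real.sqrt x) * E) := by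
    nlinarith
  exact le_of_mul_le_mul_left b4 (by positivity)

/-- The exponential factor in the Hardy–Ramanujan asymptotic formula for `p(t)`. -/
noncomputable def partitionExp (t : ℝ) : ℝ :=
  Real.exp (2 * Real.pi * Real.sqrt t / Real.sqrt 6)

lemma partitionExp_pos (t : ℝ) : 0 < partitionExp t := Real.exp_pos _

lemma partitionExp_mono {s t : ℝ} (h : s ≤ t) : partitionExp s ≤ partitionExp t := by
  unfold partitionExp
  gcongr

/-- `p(n) - p(n - 1)` to leading order, with the relative error `O(n ^ (-1/4))`. -/
theorem exists_abs_diff_card_partition_sub_le :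
    ∃ C : ℝ, 0 < C ∧ ∀ n : ℕ, 7 ≤ n →
      |((Fintype.card (Nat.Partition n) : ℝ) - (Fintype.card (Nat.Partition (n - 1)) : ℝ)) -
        Real.pi / (12 * Real.sqrt 2) * (n : ℝ) ^ (-(3 : ℝ) / 2) * partitionExp n| ≤
      C * (n : ℝ) ^ (-(7 : ℝ) / 4) * partitionExp n := by
  obtain ⟨C, hC, h⟩ := exists_norm_diff_card_partition_sub_le
  set a : ℝ := Real.pi / Real.sqrt 6 with ha
  have h6 : Real.sqrt 6 * Real.sqrt 6 = 6 := Real.mul_self_sqrt (by norm_num)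
  have h6' : 0 < Real.sqrt 6 := by positivity
  have ha0 : 0 < a := by positivity
  refine ⟨C * (a ^ 3 * Real.sqrt a), by positivity, fun n hn ↦ ?_⟩
  obtain ⟨m, rfl⟩ : ∃ m, n = m + 1 := ⟨n - 1, by omega⟩
  simp only [Nat.add_sub_cancel]
  set N : ℝ := ((m + 1 : ℕ) : ℝ) with hN
  have hN7 : (7 : ℝ) ≤ N := by rw [hN]; exact_mod_cast hn
  have hN0 : 0 < N := by linarith
  have hpi2 : Real.pi ^ 2 ≤ 10 := by nlinarith [Real.pi_lt_d2, Real.pi_pos]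
  have ha2 : a ^ 2 = Real.pi ^ 2 / 6 := by rw [ha, div_pow, sq (Real.sqrt 6), h6]
  set x : ℝ := a * N ^ (-(1 : ℝ) / 2) with hx
  have hx0 : 0 < x := by positivity
  have hNx : N * x ^ 2 = a ^ 2 := by
    have : (N ^ (-(1 : ℝ) / 2)) ^ 2 = N⁻¹ := by
      rw [← Real.rpow_natCast, ← Real.rpow_mul hN0.le, ← Real.rpow_neg_one]
      norm_num
    rw [hx, mul_pow, this]
    field_simp
  have hx2 : x ≤ 1 / 2 := by nlinarith
  have key := h m x hx0 hx2 (by rw [← hN, mul_assoc, hNx, ha2]; ring)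
  rw [← hN] at key
  have e1 : Real.exp (2 * (N * x)) = partitionExp N := by
    rw [partitionExp, Real.sqrt_eq_rpow N]
    congr 1
    have : N * N ^ (-(1 : ℝ) / 2) = N ^ ((1 : ℝ) / 2) := by
      nth_rewrite 1 [← Real.rpow_one N]
      rw [← Real.rpow_add hN0]
      norm_num
    calc 2 * (N * x) = 2 * a * (N * N ^ (-(1 : ℝ) / 2)) := by rw [hx]; ring
      _ = _ := by rw [this, ha]; ring
  have e2 : x ^ 3 = a ^ 3 * N ^ (-(3 : ℝ) / 2) := by
    rw [hx, mul_pow, ← Real.rpow_natCast (N ^ _), ← Real.rpow_mul hN0.le]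
    norm_num
  have e3 : Real.sqrt x = Real.sqrt a * N ^ (-(1 : ℝ) / 4) := by
    rw [hx, Real.sqrt_mul ha0.le, Real.sqrt_eq_rpow (N ^ _), ← Real.rpow_mul hN0.le]
    norm_num
  have e4 : N ^ (-(3 : ℝ) / 2) * N ^ (-(1 : ℝ) / 4) = N ^ (-(7 : ℝ) / 4) := by
    rw [← Real.rpow_add hN0]; norm_num
  have e5 : Real.sqrt 3 * a ^ 3 / (2 * Real.pi ^ 2) = Real.pi / (12 * Real.sqrt 2) := by
    have h62 : Real.sqrt 6 = Real.sqrt 3 * Real.sqrt 2 := by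
      rw [← Real.sqrt_mul (by norm_num)]; norm_num
    have h3 : 0 < Real.sqrt 3 := by positivity
    have h2 : 0 < Real.sqrt 2 := by positivity
    rw [pow_succ, ha2, ha, h62]
    field_simp
    norm_num
  rw [e1, e2, e3] at key
  have m1 : Real.sqrt 3 * (a ^ 3 * N ^ (-(3 : ℝ) / 2)) / (2 * Real.pi ^ 2) =
      Real.pi / (12 * Real.sqrt 2) * N ^ (-(3 : ℝ) / 2) := by rw [← e5]; ring
  have m2 : C * (a ^ 3 * N ^ (-(3 : ℝ) / 2) * (Real.sqrt a * N ^ (-(1 : ℝ) / 4))) =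
      C * (a ^ 3 * Real.sqrt a) * N ^ (-(7 : ℝ) / 4) := by rw [← e4]; ring
  rwa [m1, m2] at key

/-! ### Summation over the truncated pentagonal sum -/

lemma rpow_neg_three_halves {t : ℝ} (ht : 0 ≤ t) : t ^ (-(3 : ℝ) / 2) = 1 / Real.sqrt t ^ 3 := by
  rw [Real.sqrt_eq_rpow, ← Real.rpow_natCast, ← Real.rpow_mul ht, one_div, ← Real.rpow_neg ht]
  norm_num

/-- The main term varies slowly: moving from `n` to `m ∈ [n / 2, n]` costs a relative error
`O((n - m) / √n)`. -/
lemma abs_mainTerm_sub_le {m n : ℝ} (hn : 1 ≤ n) (hmn : m ≤ n) (hm : n / 2 ≤ m) :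
    |m ^ (-(3 : ℝ) / 2) * partitionExp m - n ^ (-(3 : ℝ) / 2) * partitionExp n| ≤
      18 * ((n - m) / Real.sqrt n ^ 4) * partitionExp n := by
  have hm0 : 0 < m := by linarith
  rw [rpow_neg_three_halves hm0.le, rpow_neg_three_halves (by linarith)]
  have hE := partitionExp_pos n
  set a := Real.sqrt m with ha
  set b := Real.sqrt n with hb
  have haa : a * a = m := Real.mul_self_sqrt hm0.le
  have hbb : b * b = n := Real.mul_self_sqrt (by linarith)
  have ha0 : 0 < a := Real.sqrt_pos.mpr hm0
  have hb1 : 1 ≤ b := Real.one_le_sqrt.mpr hn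
  have hab : a ≤ b := Real.sqrt_le_sqrt hmn
  have hd : b - a ≤ (n - m) / b := by
    rw [le_div_iff₀ (by linarith), ← haa, ← hbb]; nlinarith
  have hcube : 1 / a ^ 3 ≤ 3 / b ^ 3 := by
    rw [div_le_div_iff₀ (by positivity) (by positivity)]
    have h1 : b ≤ 3 / 2 * a := by nlinarith
    have h2 : b ^ 2 ≤ 2 * a ^ 2 := by nlinarith
    calc 1 * b ^ 3 = b ^ 2 * b := by ring
      _ ≤ (2 * a ^ 2) * (3 / 2 * a) := by gcongr
      _ = 3 * a ^ 3 := by ring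
  have hexp : partitionExp n - partitionExp m ≤ 3 * (b - a) * partitionExp n := by
    have e : partitionExp m = partitionExp n *
        Real.exp (-(2 * Real.pi / Real.sqrt 6 * (b - a))) := by
      rw [partitionExp, partitionExp, ← Real.exp_add, ← ha, ← hb]
      congr 1
      ring
    have h1 := Real.add_one_le_exp (-(2 * Real.pi / Real.sqrt 6 * (b - a)))
    have h2 : 2 * Real.pi / Real.sqrt 6 ≤ 3 := by
      have h3 : 2.4 ≤ Real.sqrt 6 := by
        rw [Real.le_sqrt (by norm_num) (by norm_num)]; norm_num
      rw [div_le_iff₀ (by linarith)]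
      linarith [Real.pi_lt_d2]
    have h4 : 2 * Real.pi / Real.sqrt 6 * (b - a) ≤ 3 * (b - a) := by
      apply mul_le_mul_of_nonneg_right h2; linarith
    rw [e]
    nlinarith
  have hmono := partitionExp_mono hmn
  have hinv : 1 / a ^ 3 - 1 / b ^ 3 ≤ 9 * (b - a) / b ^ 4 := by
    have h1 : 1 / a ^ 3 - 1 / b ^ 3 = (1 / a ^ 3) * ((b ^ 3 - a ^ 3) / b ^ 3) := by
      field_simp
    have h2 : b ^ 3 - a ^ 3 ≤ 3 * (b - a) * b ^ 2 := by
      have : b ^ 3 - a ^ 3 = (b - a) * (b ^ 2 + a * b + a ^ 2) := by ring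
      rw [this]
      have : b ^ 2 + a * b + a ^ 2 ≤ 3 * b ^ 2 := by nlinarith
      nlinarith
    have h3 : 0 ≤ b ^ 3 - a ^ 3 := sub_nonneg.mpr (by gcongr)
    rw [h1]
    calc _ ≤ (3 / b ^ 3) * ((3 * (b - a) * b ^ 2) / b ^ 3) := by gcongr
      _ = _ := by field_simp; ring
  have hinv0 : 0 ≤ 1 / a ^ 3 - 1 / b ^ 3 := by
    rw [sub_nonneg]; gcongr
  have hba : 0 ≤ b - a := by linarith
  have t1 : 1 / a ^ 3 * (partitionExp n - partitionExp m) ≤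
      9 * ((n - m) / b ^ 4) * partitionExp n := by
    calc _ ≤ 3 / b ^ 3 * (3 * ((n - m) / b) * partitionExp n) := by
          have : 3 * (b - a) * partitionExp n ≤ 3 * ((n - m) / b) * partitionExp n := by gcongr
          gcongr
          linarith
      _ = _ := by field_simp; ring
  have t2 : (1 / a ^ 3 - 1 / b ^ 3) * partitionExp n ≤
      9 * ((n - m) / b ^ 4) * partitionExp n := by
    gcongr
    refine hinv.trans ?_
    rw [mul_div_assoc]
    have hd' : b - a ≤ n - m := hd.trans (div_le_self (sub_nonneg.mpr hmn) hb1)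
    exact mul_le_mul_of_nonneg_left (div_le_div_of_nonneg_right hd' (by positivity)) (by norm_num)
  have t3 : 0 ≤ 1 / a ^ 3 * (partitionExp n - partitionExp m) :=
    mul_nonneg (by positivity) (by linarith)
  have t4 : 0 ≤ (1 / a ^ 3 - 1 / b ^ 3) * partitionExp n := by positivity
  rw [abs_le]
  constructor <;> nlinarith

/-- Telescoping: `d` consecutive differences within `δ` of `V` add up to `d V` within `d δ`. -/
lemma abs_sub_sub_mul_le {f : ℕ → ℝ} {n L : ℕ} {V δ : ℝ}
    (h : ∀ i, i < L → |f (n - i) - f (n - i - 1) - V| ≤ δ) (a d : ℕ) (hL : a + d ≤ L) :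
    |f (n - a) - f (n - (a + d)) - d * V| ≤ d * δ := by
  induction d with
  | zero => simp
  | succ d ih =>
    have h1 := ih (by omega)
    have h2 := h (a + d) (by omega)
    rw [show n - (a + (d + 1)) = n - (a + d) - 1 by omega]
    push_cast
    rw [abs_le] at *
    constructor <;> linarith

lemma sum_range_neg_one_pow_mul_odd (k : ℕ) :
    ∑ j ∈ Finset.range k, (-1 : ℝ) ^ j * (2 * j + 1) = -(-1) ^ k * k := by
  induction k with
  | zero => simp
  | succ k ih =>
    rw [Finset.sum_range_succ, ih, pow_succ]
    push_cast
    ring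

lemma sum_range_odd (k : ℕ) : ∑ j ∈ Finset.range k, (2 * (j : ℝ) + 1) = (k : ℝ) ^ 2 := by
  induction k with
  | zero => simp
  | succ k ih => rw [Finset.sum_range_succ, ih]; push_cast; ring

lemma partitionCount_natCast_sub {n a : ℕ} (h : a ≤ n) :
    partitionCount ((n : ℤ) - a) = (Fintype.card (Nat.Partition (n - a)) : ℤ) := by
  rw [partitionCount, if_pos (by omega), show ((n : ℤ) - a).toNat = n - a by omega]

/-- If `p(m) - p(m - 1)` is within `δ` of `V` on the range of the truncated sum, then `M_k(n)` is
within `k ^ 2 δ` of `k V`, since the block lengths are the odd numbers `2 j + 1`. -/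
lemma abs_andrewsMercaM_sub_le {k n : ℕ} {V δ : ℝ} (hk : 1 ≤ k) (hkn : 2 * k ^ 2 ≤ n)
    (h : ∀ i, i < 2 * k ^ 2 → |(Fintype.card (Nat.Partition (n - i)) : ℝ) -
      (Fintype.card (Nat.Partition (n - i - 1)) : ℝ) - V| ≤ δ) :
    |(andrewsMercaM k n : ℝ) - k * V| ≤ (k : ℝ) ^ 2 * δ := by
  have hblock : ∀ j ∈ Finset.range k,
      |((partitionCount ((n : ℤ) - (j : ℤ) * (3 * (j : ℤ) + 1) / 2) -
      partitionCount ((n : ℤ) - (j : ℤ) * (3 * (j : ℤ) + 5) / 2 - 1) : ℤ) : ℝ) -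
        (2 * j + 1) * V| ≤ (2 * j + 1) * δ := by
    intro j hj
    have hj' : j + 1 ≤ k := Finset.mem_range.mp hj
    obtain ⟨A, hA⟩ : ∃ A, A = j * (3 * j + 1) := ⟨_, rfl⟩
    have hle : A / 2 + (2 * j + 1) ≤ 2 * k ^ 2 := by
      have h1 : (j + 1) ^ 2 ≤ k ^ 2 := Nat.pow_le_pow_left hj' 2
      have h2 : A ≤ 3 * j ^ 2 + j := by rw [hA]; ring_nf; rfl
      have h3 : A / 2 ≤ A := Nat.div_le_self _ _
      have h4 : 2 * (A / 2) ≤ A := Nat.mul_div_le A 2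
      nlinarith
    have e1 : (n : ℤ) - (j : ℤ) * (3 * (j : ℤ) + 1) / 2 = (n : ℤ) - ((A / 2 : ℕ) : ℤ) := by
      rw [hA]; push_cast; rfl
    have e2 : (n : ℤ) - (j : ℤ) * (3 * (j : ℤ) + 5) / 2 - 1 =
        (n : ℤ) - ((A / 2 + (2 * j + 1) : ℕ) : ℤ) := by
      have : (j : ℤ) * (3 * (j : ℤ) + 5) = (A : ℤ) + 4 * j := by rw [hA]; push_cast; ring
      rw [this]
      omega
    rw [e1, e2, partitionCount_natCast_sub (by omega), partitionCount_natCast_sub (by omega)]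
    have := abs_sub_sub_mul_le (f := fun i ↦ (Fintype.card (Nat.Partition i) : ℝ)) h (A / 2)
      (2 * j + 1) hle
    push_cast at this ⊢
    exact this
  have hsign : ((-1 : ℝ) ^ (k - 1)) * (-(-1) ^ k * k) = k := by
    obtain ⟨m, rfl⟩ : ∃ m, k = m + 1 := ⟨k - 1, by omega⟩
    rw [Nat.add_sub_cancel, pow_succ]
    have : ((-1 : ℝ) ^ m) * (-1) ^ m = 1 := by rw [← mul_pow]; norm_num
    linear_combination ((m + 1 : ℕ) : ℝ) * this
  have e : (andrewsMercaM k n : ℝ) - k * V = (-1) ^ (k - 1) * ∑ j ∈ Finset.range k, (-1) ^ j *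
      (((partitionCount ((n : ℤ) - (j : ℤ) * (3 * (j : ℤ) + 1) / 2) -
      partitionCount ((n : ℤ) - (j : ℤ) * (3 * (j : ℤ) + 5) / 2 - 1) : ℤ) : ℝ) -
        (2 * j + 1) * V) := by
    have h1 : ∑ j ∈ Finset.range k, (-1 : ℝ) ^ j * ((2 * j + 1) * V) = (-(-1) ^ k * k) * V := by
      rw [← sum_range_neg_one_pow_mul_odd, Finset.sum_mul]
      exact Finset.sum_congr rfl fun j _ ↦ by ring
    simp only [mul_sub, Finset.sum_sub_distrib]
    rw [h1, ← mul_assoc, hsign]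
    simp [andrewsMercaM, mul_sub]
  rw [e, abs_mul, abs_pow, abs_neg, abs_one, one_pow, one_mul]
  calc _ ≤ ∑ j ∈ Finset.range k, (2 * (j : ℝ) + 1) * δ := by
        refine (Finset.abs_sum_le_sum_abs _ _).trans (Finset.sum_le_sum fun j hj ↦ ?_)
        rw [abs_mul, abs_pow, abs_neg, abs_one, one_pow, one_mul]
        exact hblock j hj
    _ = _ := by rw [← Finset.sum_mul, sum_range_odd]

theorem theorem1 (ε : ℝ) (hε : 0 < ε) (C : ℝ) (hC : 0 < C) :
    ∃ D : ℝ, 0 < D ∧ ∃ N : ℕ, ∀ n : ℕ, N ≤ n → ∀ k : ℕ, 1 ≤ k →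
      (k : ℝ) ≤ C * (n : ℝ) ^ ((1 : ℝ) / 8 - ε) →
      |(andrewsMercaM k n : ℝ) -
          Real.pi / (12 * Real.sqrt 2) * (k : ℝ) * (n : ℝ) ^ (-(3 : ℝ) / 2) *
            Real.exp (2 * Real.pi * Real.sqrt (n : ℝ) / Real.sqrt 6)| ≤
        D * ((k : ℝ) ^ 3 * (n : ℝ) ^ (-(7 : ℝ) / 4) *
            Real.exp (2 * Real.pi * Real.sqrt (n : ℝ) / Real.sqrt 6)) := by
  obtain ⟨C₁, hC₁, hdiff⟩ := exists_abs_diff_card_partition_sub_le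
  set κ : ℝ := Real.pi / (12 * Real.sqrt 2) with hκ
  have hκ0 : 0 < κ := by positivity
  refine ⟨4 * C₁ + κ * (36 * C ^ 2), by positivity, ⌈16 * C ^ 4⌉₊ + 14, fun n hn k hk hkC ↦ ?_⟩
  have hn14 : (14 : ℝ) ≤ n := by exact_mod_cast (by omega : 14 ≤ n)
  have hnC : 16 * C ^ 4 ≤ n := (Nat.le_ceil _).trans (by exact_mod_cast (by omega))
  have hn0 : (0 : ℝ) < n := by linarith
  have hn1 : (1 : ℝ) ≤ n := by linarith
  have hk1 : (1 : ℝ) ≤ k := by exact_mod_cast hk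
  set E : ℝ := partitionExp n with hE
  have hE0 : 0 < E := partitionExp_pos _
  have hk8 : (k : ℝ) ^ 2 ≤ C ^ 2 * (n : ℝ) ^ ((1 : ℝ) / 4) := by
    have h1 : (k : ℝ) ≤ C * (n : ℝ) ^ ((1 : ℝ) / 8) := by
      refine hkC.trans ?_
      gcongr
      linarith
    calc (k : ℝ) ^ 2 ≤ (C * (n : ℝ) ^ ((1 : ℝ) / 8)) ^ 2 := by gcongr
      _ = _ := by
        rw [mul_pow, ← Real.rpow_natCast ((n : ℝ) ^ _), ← Real.rpow_mul hn0.le]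
        norm_num
  have hkn : 4 * (k : ℝ) ^ 2 ≤ n := by
    have h1 : (n : ℝ) ^ ((1 : ℝ) / 4) ≤ Real.sqrt n := by
      rw [Real.sqrt_eq_rpow]
      exact Real.rpow_le_rpow_of_exponent_le hn1 (by norm_num)
    have h2 : 4 * C ^ 2 ≤ Real.sqrt n := by
      rw [Real.le_sqrt (by positivity) hn0.le]
      linarith
    calc 4 * (k : ℝ) ^ 2 ≤ (4 * C ^ 2) * (n : ℝ) ^ ((1 : ℝ) / 4) := by linarith
      _ ≤ Real.sqrt n * Real.sqrt n := by gcongr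
      _ = n := Real.mul_self_sqrt hn0.le
  have hkn' : 4 * k ^ 2 ≤ n := by exact_mod_cast hkn
  have hn4 : (n : ℝ) ^ ((1 : ℝ) / 4) / Real.sqrt n ^ 4 = (n : ℝ) ^ (-(7 : ℝ) / 4) := by
    have : Real.sqrt n ^ 4 = (n : ℝ) ^ (2 : ℝ) := by
      rw [Real.sqrt_eq_rpow, ← Real.rpow_natCast, ← Real.rpow_mul hn0.le]
      norm_num
    rw [this, ← Real.rpow_sub hn0]
    norm_num
  set W : ℝ := (n : ℝ) ^ (-(7 : ℝ) / 4) with hW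
  have hW0 : 0 < W := by positivity
  have hlocal : ∀ i, i < 2 * k ^ 2 → |(Fintype.card (Nat.Partition (n - i)) : ℝ) -
      (Fintype.card (Nat.Partition (n - i - 1)) : ℝ) - κ * ((n : ℝ) ^ (-(3 : ℝ) / 2) * E)| ≤
      (4 * C₁ + κ * (36 * C ^ 2)) * (W * E) := by
    intro i hi
    have hin : i ≤ n := by omega
    have hcast : ((n - i : ℕ) : ℝ) = n - i := Nat.cast_sub hin
    have hi' : (i : ℝ) ≤ 2 * (k : ℝ) ^ 2 := by exact_mod_cast hi.le
    have h1 := hdiff (n - i) (by omega)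
    have hm2 : (n : ℝ) / 2 ≤ ((n - i : ℕ) : ℝ) := by rw [hcast]; linarith
    have hmn : ((n - i : ℕ) : ℝ) ≤ n := by
      rw [hcast]
      linarith [(Nat.cast_nonneg i : (0 : ℝ) ≤ i)]
    have h2 := abs_mainTerm_sub_le hn1 hmn hm2
    set m : ℝ := ((n - i : ℕ) : ℝ) with hm
    have hm0 : 0 < m := by linarith
    have h3 : C₁ * m ^ (-(7 : ℝ) / 4) * partitionExp m ≤ 4 * C₁ * (W * E) := by
      have h4 : m ^ (-(7 : ℝ) / 4) ≤ 4 * W := by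
        calc m ^ (-(7 : ℝ) / 4) ≤ ((n : ℝ) / 2) ^ (-(7 : ℝ) / 4) :=
              Real.rpow_le_rpow_of_nonpos (by positivity) hm2 (by norm_num)
          _ = W * 2 ^ ((7 : ℝ) / 4) := by
              rw [Real.div_rpow hn0.le (by norm_num), div_eq_mul_inv,
                ← Real.rpow_neg (by norm_num)]
              norm_num
              rw [hW, neg_div]
          _ ≤ W * 2 ^ (2 : ℝ) := by
              gcongr
              · norm_num
              · norm_num
          _ = 4 * W := by norm_num; ring
      have h5 := partitionExp_mono hmn
      calc _ ≤ C₁ * (4 * W) * E := by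
            have := partitionExp_pos m
            gcongr
        _ = _ := by ring
    have h6 : 18 * (((n : ℝ) - m) / Real.sqrt n ^ 4) * E ≤ 36 * C ^ 2 * (W * E) := by
      have h7 : (n : ℝ) - m ≤ 2 * (C ^ 2 * (n : ℝ) ^ ((1 : ℝ) / 4)) := by rw [hcast]; linarith
      calc _ ≤ 18 * ((2 * (C ^ 2 * (n : ℝ) ^ ((1 : ℝ) / 4))) / Real.sqrt n ^ 4) * E := by gcongr
        _ = 36 * C ^ 2 * ((n : ℝ) ^ ((1 : ℝ) / 4) / Real.sqrt n ^ 4 * E) := by ring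
        _ = _ := by rw [hn4]
    have h8 : |κ * (m ^ (-(3 : ℝ) / 2) * partitionExp m) - κ * ((n : ℝ) ^ (-(3 : ℝ) / 2) * E)| ≤
        κ * (36 * C ^ 2 * (W * E)) := by
      rw [← mul_sub, abs_mul, abs_of_pos hκ0]
      exact mul_le_mul_of_nonneg_left (h2.trans h6) hκ0.le
    have h9 := h1.trans h3
    rw [mul_assoc κ] at h9
    rw [abs_le] at h8 h9 ⊢
    constructor <;> linarith
  have hfin := abs_andrewsMercaM_sub_le hk (by omega) hlocal
  have hk23 : (k : ℝ) ^ 2 ≤ (k : ℝ) ^ 3 := pow_le_pow_right₀ hk1 (by norm_num)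
  have e1 : (k : ℝ) * (κ * ((n : ℝ) ^ (-(3 : ℝ) / 2) * E)) =
      κ * (k : ℝ) * (n : ℝ) ^ (-(3 : ℝ) / 2) * E := by ring
  rw [e1] at hfin
  refine hfin.trans ?_
  change _ ≤ (4 * C₁ + κ * (36 * C ^ 2)) * ((k : ℝ) ^ 3 * W * E)
  calc _ ≤ (k : ℝ) ^ 3 * ((4 * C₁ + κ * (36 * C ^ 2)) * (W * E)) := by gcongr
    _ = _ := by ring
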